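/- Let $\omega=(0,1)^2$, let $L_1,L_2>0$, and let $G:\mathbb R^2\to\mathbb R$ be smooth, $L_1$-periodic in the first and $L_2$-periodic in the second variable, with $0<G_0\le G\le G_1$ for constants $G_0,G_1$. Write $x=(\hat x,x_3)\in\mathbb R^2\times\mathbb R$, and for $\varepsilon>0$ set $$\Omega_\varepsilon=\{(\hat x,x_3):\hat x\in\omega,\ 0<x_3<\varepsilon G(\hat x/\varepsilon)\},\quad \tilde\Omega_\varepsilon=\{(\hat x,y_3):\hat x\in\omega,\ 0<y_3<G(\hat x/\varepsilon)\},\quad \Omega=\omega\times(0,G_1),$$ and $V_\varepsilon=\{v\in H^1_0(\Omega_\varepsilon)^3:\operatorname{div}v=0\}$. Fix $\mu,g>0$. Let $\mathbf f_\varepsilon\in L^2(\Omega_\varepsilon)^3$ satisfy $\varepsilon^{-1/2}\|\mathbf f_\varepsilon\|_{L^2(\Omega_\varepsilon)^3}\le C$ with $C$ independent of $\varepsilon$, and let $\mathbf u_\varepsilon\in V_\varepsilon$ be the Bingham velocity, i.e. the solution of $$\mu\varepsilon^2\int_{\Omega_\varepsilon}\nabla \mathbf u_\varepsilon\cdot\nabla(\mathbf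 v-\mathbf u_\varepsilon)\,dx+g\varepsilon\int_{\Omega_\varepsilon}|\nabla \mathbf v|\,dx-g\varepsilon\int_{\Omega_\varepsilon}|\nabla \mathbf u_\varepsilon|\,dx\ \ge\ \int_{\Omega_\varepsilon}\mathbf f_\varepsilon\cdot(\mathbf v-\mathbf u_\varepsilon)\,dx\qquad\forall\,\mathbf v\in V_\varepsilon,$$ where $|\cdot|$ is the Euclidean (Frobenius) norm. Let $\tilde{\mathbf U}_\varepsilon$ be the extension by zero to $\Omega$ of $\mathbf U_\varepsilon(\hat x,y_3)=\mathbf u_\varepsilon(\hat x,\varepsilon y_3)$, $(\hat x,y_3)\in\tilde\Omega_\varepsilon$. Then $\tilde{\mathbf U}_\varepsilon\in H^1_0(\Omega)^3$ and $\tilde{\mathbf U}_\varepsilon\in H^1((0,G_1);L^2(\omega)^3)$. From every sequence of positive $\varepsilon$ tending to $0$ one can extract a subsequence along which, for some $\mathbf U\in H^1((0,G_1);L^2(\omega)^3)$, $$\tilde{\mathbf U}_\varepsilon\rightharpoonup \mathbf U\quad\text{weakly in }H^1((0,G_1);L^2(\omega)^3).$$ Moreover $\mathbf U=(\hat U,0)$,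 that is $U_3=0$ almost everywhere, and the field $\int_0^{G_1}\hat U(\cdot,y_3)\,dy_3\in L^2(\omega)^2$ satisfies $$\operatorname{div}_{\hat x}\Big(\int_0^{G_1}\hat U(\hat x,y_3)\,dy_3\Big)=0\ \text{ in }\omega,\qquad \Big(\int_0^{G_1}\hat U(\hat x,y_3)\,dy_3\Big)\cdot n=0\ \text{ on }\partial\omega,$$ the divergence being taken in the sense of distributions, $n$ being the outward normal to $\omega$, and the normal trace of a field $V\in L^2(\omega)^2$ with $\operatorname{div}V\in L^2(\omega)$ being defined by Green's formula $\langle V\cdot n,\psi\rangle=\int_\omega V\cdot\nabla\psi+\int_\omega(\operatorname{div}V)\,\psi$ for $\psi\in H^1(\omega)$. -/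

import Mathlib

open MeasureTheory Filter Topology
open scoped ContDiff InnerProductSpace

namespace BinghamThin

noncomputable section

/-! ### Sobolev spaces on an open subset of Euclidean space -/

/-- Gradients of `F`-valued functions of `d` variables: `(∇u) j = ∂ⱼ u`. The norm and the inner
product are the Euclidean (Frobenius) ones, `∇u · ∇v = ∑ⱼ ∂ⱼu · ∂ⱼv` and `|∇u|² = ∑ⱼ |∂ⱼu|²`. -/
abbrev Grad (d : ℕ) (F : Type*) := PiLp 2 (fun _ : Fin d => F)

/-- The classical gradient of a differentiable function. -/
def classicalGrad {d : ℕ} {F : Type*} [NormedAddCommGroup F] [NormedSpace ℝ F]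
    (φ : EuclideanSpace ℝ (Fin d) → F) (x : EuclideanSpace ℝ (Fin d)) : Grad d F :=
  WithLp.toLp 2 (fun j => fderiv ℝ φ x (EuclideanSpace.single j 1))

/-- Test functions: smooth functions with compact support contained in `Ω`. -/
def IsTest {E F : Type*} [NormedAddCommGroup E] [NormedSpace ℝ E]
    [NormedAddCommGroup F] [NormedSpace ℝ F] (Ω : Set E) (φ : E → F) : Prop :=
  ContDiff ℝ ∞ φ ∧ HasCompactSupport φ ∧ tsupport φ ⊆ Ω

/-- `u ∈ H¹(Ω)` and `Du` is its weak gradient. Only the values in `Ω` matter. -/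
def HasH1Grad {d : ℕ} {F : Type*} [NormedAddCommGroup F] [NormedSpace ℝ F] [CompleteSpace F]
    (Ω : Set (EuclideanSpace ℝ (Fin d))) (u : EuclideanSpace ℝ (Fin d) → F)
    (Du : EuclideanSpace ℝ (Fin d) → Grad d F) : Prop :=
  MemLp u 2 (volume.restrict Ω) ∧ MemLp Du 2 (volume.restrict Ω) ∧
    ∀ φ : EuclideanSpace ℝ (Fin d) → ℝ, IsTest Ω φ → ∀ j : Fin d,
      ∫ x in Ω, classicalGrad φ x j • u x = -∫ x in Ω, φ x • Du x j

/-- `u ∈ H¹₀(Ω)` with weak gradient `Du`: `u ∈ H¹(Ω)` is a limit, for the `H¹` norm, of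
test functions on `Ω`. -/
def HasH10Grad {d : ℕ} {F : Type*} [NormedAddCommGroup F] [NormedSpace ℝ F] [CompleteSpace F]
    (Ω : Set (EuclideanSpace ℝ (Fin d))) (u : EuclideanSpace ℝ (Fin d) → F)
    (Du : EuclideanSpace ℝ (Fin d) → Grad d F) : Prop :=
  HasH1Grad Ω u Du ∧ ∃ φ : ℕ → EuclideanSpace ℝ (Fin d) → F, (∀ k, IsTest Ω (φ k)) ∧
    Tendsto (fun k => eLpNorm (φ k - u) 2 (volume.restrict Ω)) atTop (𝓝 0) ∧
    Tendsto (fun k => eLpNorm (classicalGrad (φ k) - Du) 2 (volume.restrict Ω)) atTop (𝓝 0)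

/-- Membership in `H¹₀(Ω)`. -/
def MemH10 {d : ℕ} {F : Type*} [NormedAddCommGroup F] [NormedSpace ℝ F] [CompleteSpace F]
    (Ω : Set (EuclideanSpace ℝ (Fin d))) (u : EuclideanSpace ℝ (Fin d) → F) : Prop :=
  ∃ Du, HasH10Grad Ω u Du

/-- The field `V ∈ L²(Ω)ᵈ` has the distributional divergence `δ ∈ L²(Ω)` in `Ω`. -/
def HasWeakDiv {d : ℕ} (Ω : Set (EuclideanSpace ℝ (Fin d)))
    (V : EuclideanSpace ℝ (Fin d) → EuclideanSpace ℝ (Fin d))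
    (δ : EuclideanSpace ℝ (Fin d) → ℝ) : Prop :=
  MemLp V 2 (volume.restrict Ω) ∧ MemLp δ 2 (volume.restrict Ω) ∧
    ∀ φ : EuclideanSpace ℝ (Fin d) → ℝ, IsTest Ω φ →
      ∫ x in Ω, ⟪V x, classicalGrad φ x⟫_ℝ = -∫ x in Ω, δ x * φ x

/-- `V · n = 0` on `∂Ω`, for a field `V ∈ L²(Ω)ᵈ` with `div V ∈ L²(Ω)`. The normal trace of such
a field is the functional on traces of `H¹(Ω)` functions given by Green's formula,
`⟨V · n, ψ⟩ = ∫_Ω V · ∇ψ + ∫_Ω (div V) ψ` for `ψ ∈ H¹(Ω)`; it is required to vanish. -/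
def ZeroNormalTrace {d : ℕ} (Ω : Set (EuclideanSpace ℝ (Fin d)))
    (V : EuclideanSpace ℝ (Fin d) → EuclideanSpace ℝ (Fin d)) : Prop :=
  ∃ δ : EuclideanSpace ℝ (Fin d) → ℝ, HasWeakDiv Ω V δ ∧
    ∀ (ψ : EuclideanSpace ℝ (Fin d) → ℝ) (Dψ : EuclideanSpace ℝ (Fin d) → Grad d ℝ),
      HasH1Grad Ω ψ Dψ → (∫ x in Ω, ⟪V x, Dψ x⟫_ℝ) + ∫ x in Ω, δ x * ψ x = 0

/-! ### The space `H¹((a, b); X)` of vector-valued functions -/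

theorem integrable_smul_Lp {X : Type*} [NormedAddCommGroup X] [NormedSpace ℝ X] {a b : ℝ}
    {φ : ℝ → ℝ} (hφ : Continuous φ) (hc : HasCompactSupport φ)
    (u : Lp X 2 (volume.restrict (Set.Ioo a b))) :
    Integrable (fun t => φ t • u t) (volume.restrict (Set.Ioo a b)) := by
  have hu : Integrable u (volume.restrict (Set.Ioo a b)) :=
    (Lp.memLp u).integrable one_le_two
  obtain ⟨C, hC⟩ := hc.exists_bound_of_continuous hφ
  exact hu.bdd_smul C hφ.aestronglyMeasurable (ae_of_all _ hC)

/-- The Hilbert space `H¹((a, b); X)`: pairs `(u, u')` in `L²((a, b); X)²` such that `u'` is the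
weak derivative of `u`, with the norm `(‖u‖² + ‖u'‖²)^(1/2)`. -/
def H1 (a b : ℝ) (X : Type*) [NormedAddCommGroup X] [NormedSpace ℝ X]
    [CompleteSpace X] :
    Submodule ℝ (WithLp 2 (Lp X 2 (volume.restrict (Set.Ioo a b)) ×
      Lp X 2 (volume.restrict (Set.Ioo a b)))) where
  carrier := {p | ∀ φ : ℝ → ℝ, IsTest (Set.Ioo a b) φ →
    ∫ t in Set.Ioo a b, deriv φ t • p.fst t = -∫ t in Set.Ioo a b, φ t • p.snd t}
  zero_mem' := by
    intro φ _
    have h : ∀ (ψ : ℝ → ℝ), ∫ t in Set.Ioo a b,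
        ψ t • (0 : Lp X 2 (volume.restrict (Set.Ioo a b))) t = 0 := by
      intro ψ
      rw [integral_eq_zero_of_ae]
      filter_upwards [Lp.coeFn_zero X 2 (volume.restrict (Set.Ioo a b))] with t ht
      rw [ht, Pi.zero_apply, smul_zero]
    have h1 := h (deriv φ)
    have h2 := h φ
    simp only [WithLp.zero_fst, WithLp.zero_snd, h1, h2, neg_zero]
  add_mem' := by
    intro p q hp hq φ hφ
    have hd : Continuous (deriv φ) := hφ.1.continuous_deriv (by simp)
    have key : ∀ (ψ : ℝ → ℝ), Continuous ψ → HasCompactSupport ψ →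
        ∀ u v : Lp X 2 (volume.restrict (Set.Ioo a b)),
        ∫ t in Set.Ioo a b, ψ t • (u + v) t =
          (∫ t in Set.Ioo a b, ψ t • u t) + ∫ t in Set.Ioo a b, ψ t • v t := by
      intro ψ hψ hc u v
      rw [← integral_add (integrable_smul_Lp hψ hc u) (integrable_smul_Lp hψ hc v)]
      refine integral_congr_ae ?_
      filter_upwards [Lp.coeFn_add u v] with t ht
      rw [ht, Pi.add_apply, smul_add]
    simp only [WithLp.add_fst, WithLp.add_snd]
    rw [key _ hd hφ.2.1.deriv, key _ hφ.1.continuous hφ.2.1, hp φ hφ, hq φ hφ]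
    abel
  smul_mem' := by
    intro c p hp φ hφ
    have key : ∀ (ψ : ℝ → ℝ) (u : Lp X 2 (volume.restrict (Set.Ioo a b))),
        ∫ t in Set.Ioo a b, ψ t • (c • u) t = c • ∫ t in Set.Ioo a b, ψ t • u t := by
      intro ψ u
      rw [← integral_smul]
      refine integral_congr_ae ?_
      filter_upwards [Lp.coeFn_smul c u] with t ht
      rw [ht, Pi.smul_apply, smul_comm]
    simp only [WithLp.smul_fst, WithLp.smul_snd]
    rw [key, key, hp φ hφ, smul_neg]

/-- The function `t ↦ u(t)` underlying an element of `H¹((a, b); X)`. -/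
def h1Fun {a b : ℝ} {X : Type*} [NormedAddCommGroup X] [NormedSpace ℝ X]
    [CompleteSpace X] (u : H1 a b X) : ℝ → X :=
  (u : WithLp 2 (Lp X 2 (volume.restrict (Set.Ioo a b)) ×
    Lp X 2 (volume.restrict (Set.Ioo a b)))).fst

/-- Weak convergence in a normed space. -/
def WeakTendsto {E : Type*} [NormedAddCommGroup E] [NormedSpace ℝ E] (x : ℕ → E) (a : E) : Prop :=
  Tendsto (fun n => toWeakSpace ℝ E (x n)) atTop (𝓝 (toWeakSpace ℝ E a))

/-! ### The thin domain and the Bingham problem -/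

/-- The plane and the space with their Euclidean norms. -/
abbrev E2 := EuclideanSpace ℝ (Fin 2)

/-- See `E2`. -/
abbrev E3 := EuclideanSpace ℝ (Fin 3)

/-- The horizontal part `x̂ = (x₁, x₂)` of `x = (x̂, x₃)`. -/
def hat : E3 →L[ℝ] E2 :=
  LinearMap.toContinuousLinearMap
    { toFun := fun x => !₂[x 0, x 1]
      map_add' := fun x y => by ext i; fin_cases i <;> simp
      map_smul' := fun c x => by ext i; fin_cases i <;> simp }

/-- The point `(x̂, t)`. -/
def join (x : E2) (t : ℝ) : E3 := !₂[x 0, x 1, t]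

/-- `ω = (0, 1)²`. -/
def omega : Set E2 := {x | ∀ i, 0 < x i ∧ x i < 1}

/-- `Ω_ε`, given by `x̂ ∈ ω` and `0 < x₃ < ε G(x̂ / ε)`. -/
def thinDomain (G : E2 → ℝ) (ε : ℝ) : Set E3 :=
  {x | hat x ∈ omega ∧ 0 < x 2 ∧ x 2 < ε * G (ε⁻¹ • hat x)}

/-- The vertically stretched domain, given by `x̂ ∈ ω` and `0 < y₃ < G(x̂ / ε)`. -/
def stretchedDomain (G : E2 → ℝ) (ε : ℝ) : Set E3 :=
  {x | hat x ∈ omega ∧ 0 < x 2 ∧ x 2 < G (ε⁻¹ • hat x)}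

/-- `Ω = ω × (0, G₁)`. -/
def fixedDomain (G₁ : ℝ) : Set E3 := {x | hat x ∈ omega ∧ 0 < x 2 ∧ x 2 < G₁}

/-- `v ∈ V`, the divergence-free fields of `H¹₀(Ω)³`, and `Dv` is the gradient of `v`. -/
def IsAdmissible (Ω : Set E3) (v : E3 → E3) (Dv : E3 → Grad 3 E3) : Prop :=
  HasH10Grad Ω v Dv ∧ ∀ᵐ x ∂(volume.restrict Ω), ∑ j : Fin 3, Dv x j j = 0

/-- `u` is the velocity of the Bingham flow in `Ω_ε` with viscosity `μ ε²`, yield stress `g ε` and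
body force `f`, that is, it solves the variational inequality in the space of admissible fields. -/
def IsBinghamVelocity (μ g : ℝ) (G : E2 → ℝ) (ε : ℝ) (f u : E3 → E3) : Prop :=
  ∃ Du : E3 → Grad 3 E3, IsAdmissible (thinDomain G ε) u Du ∧
    ∀ (v : E3 → E3) (Dv : E3 → Grad 3 E3), IsAdmissible (thinDomain G ε) v Dv →
      μ * ε ^ 2 * (∫ x in thinDomain G ε, ⟪Du x, Dv x - Du x⟫_ℝ)
          + g * ε * (∫ x in thinDomain G ε, ‖Dv x‖) - g * ε * (∫ x in thinDomain G ε, ‖Du x‖)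
        ≥ ∫ x in thinDomain G ε, ⟪f x, v x - u x⟫_ℝ

/-- The rescaled norm `ε^(-1/2) ‖φ‖` of `L²(Ω_ε)`. -/
def rescaledL2Norm (G : E2 → ℝ) (ε : ℝ) (φ : E3 → E3) : ℝ :=
  ε ^ (-(1 / 2) : ℝ) * (eLpNorm φ 2 (volume.restrict (thinDomain G ε))).toReal

/-- The extension by zero of the rescaled velocity `(x̂, y₃) ↦ u(x̂, ε y₃)`. -/
def rescaledVelocity (G : E2 → ℝ) (ε : ℝ) (u : E3 → E3) : E3 → E3 :=
  (stretchedDomain G ε).indicator (fun x => u (join (hat x) (ε * x 2)))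

/-- `L²(ω)³`. -/
abbrev L2omega3 := Lp E3 2 (volume.restrict omega)

/-- The element `W` of `H¹((0, G₁); L²(ω)³)` is the function `w` of `(x̂, y₃)`. -/
def Represents {G₁ : ℝ} (W : H1 0 G₁ L2omega3) (w : E3 → E3) : Prop :=
  ∀ᵐ t ∂(volume.restrict (Set.Ioo 0 G₁)), ∀ᵐ x ∂(volume.restrict omega),
    h1Fun W t x = w (join x t)

/-- `∫₀^{G₁} Û(·, y₃) dy₃ ∈ L²(ω)²`, where `Û` is the horizontal part of `U`. -/
def verticalIntegral {G₁ : ℝ} (U : H1 0 G₁ L2omega3) : Lp E2 2 (volume.restrict omega) :=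
  ∫ t in Set.Ioo 0 G₁, hat.compLp (h1Fun U t)

end

end BinghamThin

namespace BinghamThin

/-!
Testing the variational inequality with `v = 0`, the plastic terms drop out and leave the energy
estimate `μ ε² ‖∇u‖² ≤ ‖f‖ ‖u‖` in the thin domain. Stretching the vertical variable and extending
by zero turns it into a bound, uniform in `ε`, for `∂₃ U_ε` in `L²(Ω)`: the Poincaré inequality in
the vertical direction, in which the field vanishes at both ends, controls the remaining factor.
The profiles are therefore bounded in the Hilbert space `H¹((0, G₁); L²(ω)³)`, and weak sequential
compactness yields the subsequence.

The equation `ε div_x̂ Û_ε + ∂₃ U_ε,₃ = 0`, with zero boundary values, is tested with products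
`a(y₃) b(x̂)`. For general `a` its weak limit is `∂₃ U₃ = 0` together with a zero flux through the
two ends, and since every smooth function has a primitive, `U₃ = 0`. For `a = 1` the vertical term
disappears and `ε` can be divided out: the vertical mean of `Û_ε` is orthogonal in `L²(ω)²` to all
gradients of `H¹(ω)` functions. This survives in the limit and is precisely the vanishing of the
divergence and of the normal trace.
-/

noncomputable section

/-! ### Pairings and limits in `Lᵖ` -/

section Lebesgue

variable {α F H : Type*} [MeasurableSpace α] {m : Measure α}
  [NormedAddCommGroup F] [NormedSpace ℝ F] [NormedAddCommGroup H] [NormedSpace ℝ H]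
  {p q : ENNReal}

/-- The pairing `u ↦ ∫ a • u` of `Lᑫ` with a scalar weight `a ∈ Lᵖ`, as a continuous linear map. -/
@[irreducible]
def smulIntegral [CompleteSpace F] [p.HolderConjugate q] [Fact (1 ≤ p)] [Fact (1 ≤ q)] {a : α → ℝ}
    (ha : MemLp a p m) : Lp F q m →L[ℝ] F :=
  (ContinuousLinearMap.lsmul ℝ ℝ).lpPairing m p q (ha.toLp a)

section SmulIntegral

variable [p.HolderConjugate q] {a : α → ℝ}

theorem integrable_smul_of_memLp (ha : MemLp a p m) {u : α → F} (hu : MemLp u q m) :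
    Integrable (fun x => a x • u x) m :=
  memLp_one_iff_integrable.1 (hu.smul ha)

theorem integral_smul_compLp [CompleteSpace F] [CompleteSpace H] (L : F →L[ℝ] H)
    (ha : MemLp a p m) (u : Lp F q m) :
    ∫ x, a x • L.compLp u x ∂m = L (∫ x, a x • u x ∂m) := by
  rw [← L.integral_comp_comm (integrable_smul_of_memLp ha (Lp.memLp u))]
  refine integral_congr_ae ?_
  filter_upwards [L.coeFn_compLp u] with x hx
  rw [hx, L.map_smul]

variable [CompleteSpace F] [Fact (1 ≤ p)] [Fact (1 ≤ q)]

theorem smulIntegral_apply (ha : MemLp a p m) (u : Lp F q m) :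
    smulIntegral ha u = ∫ x, a x • u x ∂m := by
  rw [smulIntegral, ContinuousLinearMap.lpPairing_eq_integral]
  refine integral_congr_ae ?_
  filter_upwards [ha.coeFn_toLp] with x hx
  rw [hx, ContinuousLinearMap.lsmul_apply]

theorem smulIntegral_toLp (ha : MemLp a p m) {u : α → F} (hu : MemLp u q m) :
    smulIntegral ha (hu.toLp u) = ∫ x, a x • u x ∂m := by
  rw [smulIntegral_apply]
  refine integral_congr_ae ?_
  filter_upwards [hu.coeFn_toLp] with x hx
  rw [hx]

theorem tendsto_integral_smul (ha : MemLp a p m) {u : ℕ → α → F} {v : α → F}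
    (hu : ∀ k, MemLp (u k) q m) (hv : MemLp v q m)
    (h : Tendsto (fun k => eLpNorm (u k - v) q m) atTop (𝓝 0)) :
    Tendsto (fun k => ∫ x, a x • u k x ∂m) atTop (𝓝 (∫ x, a x • v x ∂m)) := by
  simp_rw [← smulIntegral_toLp ha hv, ← fun k => smulIntegral_toLp ha (hu k)]
  exact ((smulIntegral ha).continuous.tendsto _).comp
    ((Lp.tendsto_Lp_iff_tendsto_eLpNorm'' u hu v hv).2 h)

end SmulIntegral

theorem tendsto_eLpNorm_comp_sub_comp (L : F →L[ℝ] H) {u : ℕ → α → F} {v : α → F}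
    (h : Tendsto (fun k => eLpNorm (u k - v) p m) atTop (𝓝 0)) :
    Tendsto (fun k => eLpNorm ((fun x => L (u k x)) - fun x => L (v x)) p m) atTop (𝓝 0) := by
  have hL : Tendsto (fun k => ENNReal.ofReal ‖L‖ * eLpNorm (u k - v) p m) atTop (𝓝 0) := by
    simpa only [mul_zero] using ENNReal.Tendsto.const_mul h (Or.inr ENNReal.ofReal_ne_top)
  refine tendsto_of_tendsto_of_tendsto_of_le_of_le tendsto_const_nhds hL (fun _ => zero_le)
    fun k => eLpNorm_le_mul_eLpNorm_of_ae_le_mul (ae_of_all _ fun x => ?_) p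
  rw [Pi.sub_apply, ← L.map_sub]
  exact L.le_opNorm _

omit [NormedSpace ℝ F] in
theorem tendsto_toReal_eLpNorm [Fact (1 ≤ p)] {u : ℕ → α → F} {v : α → F}
    (hu : ∀ k, MemLp (u k) p m) (hv : MemLp v p m)
    (h : Tendsto (fun k => eLpNorm (u k - v) p m) atTop (𝓝 0)) :
    Tendsto (fun k => (eLpNorm (u k) p m).toReal) atTop (𝓝 (eLpNorm v p m).toReal) := by
  simp_rw [← Lp.norm_toLp v hv, ← fun k => Lp.norm_toLp (u k) (hu k)]
  exact ((Lp.tendsto_Lp_iff_tendsto_eLpNorm'' u hu v hv).2 h).norm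

omit [NormedSpace ℝ F] in
theorem memLp_restrict_of_continuous {E : Type*} [PseudoMetricSpace E] [ProperSpace E]
    [MeasurableSpace E] [OpensMeasurableSpace E] {m : Measure E} [IsFiniteMeasureOnCompacts m]
    {Ω : Set E} (hΩ : Bornology.IsBounded Ω) {φ : E → F} (hφ : Continuous φ) :
    MemLp φ p (m.restrict Ω) := by
  have hc : IsCompact (closure Ω) := hΩ.isCompact_closure
  obtain ⟨C, hC⟩ := hc.exists_bound_of_continuousOn hφ.continuousOn
  have : IsFiniteMeasure (m.restrict (closure Ω)) := isFiniteMeasure_restrict.2 hc.measure_lt_top.ne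
  exact (MemLp.of_bound hφ.aestronglyMeasurable C
    (ae_restrict_of_forall_mem isClosed_closure.measurableSet hC)).mono_measure
      (Measure.restrict_mono_set m subset_closure)

end Lebesgue

section CauchySchwarz

variable {α F : Type*} [MeasurableSpace α] {m : Measure α} [NormedAddCommGroup F]
  [InnerProductSpace ℝ F] {u v : α → F}

theorem integral_inner_eq_inner_toLp (hu : MemLp u 2 m) (hv : MemLp v 2 m) :
    ∫ x, ⟪u x, v x⟫_ℝ ∂m = ⟪hu.toLp u, hv.toLp v⟫_ℝ := by
  rw [L2.inner_def]
  refine integral_congr_ae ?_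
  filter_upwards [hu.coeFn_toLp, hv.coeFn_toLp] with x hux hvx
  rw [hux, hvx]

theorem integral_inner_le_eLpNorm_mul_eLpNorm (hu : MemLp u 2 m) (hv : MemLp v 2 m) :
    ∫ x, ⟪u x, v x⟫_ℝ ∂m ≤ (eLpNorm u 2 m).toReal * (eLpNorm v 2 m).toReal := by
  rw [integral_inner_eq_inner_toLp hu hv, ← Lp.norm_toLp u hu, ← Lp.norm_toLp v hv]
  exact real_inner_le_norm _ _

theorem integral_inner_self_eq_eLpNorm_sq (hu : MemLp u 2 m) :
    ∫ x, ⟪u x, u x⟫_ℝ ∂m = (eLpNorm u 2 m).toReal ^ 2 := by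
  rw [integral_inner_eq_inner_toLp hu hu, ← Lp.norm_toLp u hu, real_inner_self_eq_norm_sq]

end CauchySchwarz

/-! ### Test functions -/

section IsTest

variable {E F H : Type*} [NormedAddCommGroup E] [NormedSpace ℝ E] [NormedAddCommGroup F]
  [NormedSpace ℝ F] [NormedAddCommGroup H] [NormedSpace ℝ H] {Ω : Set E} {φ : E → F}

theorem IsTest.comp_left (hφ : IsTest Ω φ) {g : F → H} (hg : ContDiff ℝ ∞ g) (hg0 : g 0 = 0) :
    IsTest Ω fun x => g (φ x) :=
  ⟨hg.comp hφ.1, hφ.2.1.comp_left hg0,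
    (closure_mono (Function.support_comp_subset hg0 φ)).trans hφ.2.2⟩

theorem IsTest.comp_of_leftInverse (hφ : IsTest Ω φ) {g : H → E} {r : E → H} {Ω' : Set H}
    (hg : ContDiff ℝ ∞ g) (hr : Continuous r) (hrg : Function.LeftInverse r g)
    (hΩ : g ⁻¹' Ω ⊆ Ω') : IsTest Ω' fun x => φ (g x) :=
  ⟨hφ.1.comp hg, hφ.2.1.comp_isClosedEmbedding (hrg.isClosedEmbedding hr hg.continuous),
    (tsupport_comp_subset_preimage φ hg.continuous).trans
      ((Set.preimage_mono hφ.2.2).trans hΩ)⟩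

theorem IsTest.deriv {φ : ℝ → ℝ} {I : Set ℝ} (hφ : IsTest I φ) : IsTest I (deriv φ) :=
  ⟨by simpa using hφ.1.iterate_deriv 1, hφ.2.1.deriv, tsupport_deriv_subset.trans hφ.2.2⟩

theorem IsTest.setIntegral_smul [MeasurableSpace E] {φ : E → ℝ} (hφ : IsTest Ω φ) (m : Measure E)
    (u : E → F) : ∫ x in Ω, φ x • u x ∂m = ∫ x, φ x • u x ∂m :=
  setIntegral_eq_integral_of_forall_compl_eq_zero fun x hx => by
    rw [image_eq_zero_of_notMem_tsupport fun h => hx (hφ.2.2 h), zero_smul]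

variable [MeasurableSpace E]

theorem IsTest.memLp [OpensMeasurableSpace E] (hφ : IsTest Ω φ) (p : ENNReal) (m : Measure E)
    [IsFiniteMeasureOnCompacts m] : MemLp φ p m :=
  hφ.1.continuous.memLp_of_hasCompactSupport hφ.2.1

theorem IsTest.integral_fderiv_smul [FiniteDimensional ℝ E] [BorelSpace E] {φ : E → ℝ}
    (hφ : IsTest Ω φ) (m : Measure E) [m.IsAddHaarMeasure] {ψ : E → F} (hψ : ContDiff ℝ ∞ ψ)
    (v : E) :
    ∫ x in Ω, fderiv ℝ φ x v • ψ x ∂m = -∫ x in Ω, φ x • fderiv ℝ ψ x v ∂m := by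
  have hdφ : IsTest Ω fun x => fderiv ℝ φ x v :=
    ⟨(hφ.1.fderiv_right (m := ∞) le_rfl).clm_apply contDiff_const, hφ.2.1.fderiv_apply ℝ v,
      (tsupport_fderiv_apply_subset ℝ v).trans hφ.2.2⟩
  have hdψ : Continuous fun x => fderiv ℝ ψ x v :=
    (hψ.continuous_fderiv (by simp)).clm_apply continuous_const
  rw [hdφ.setIntegral_smul, hφ.setIntegral_smul,
    integral_smul_fderiv_eq_neg_fderiv_smul_of_integrable
      ((hdφ.1.continuous.smul hψ.continuous).integrable_of_hasCompactSupport hdφ.2.1.smul_right)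
      ((hφ.1.continuous.smul hdψ).integrable_of_hasCompactSupport hφ.2.1.smul_right)
      ((hφ.1.continuous.smul hψ.continuous).integrable_of_hasCompactSupport hφ.2.1.smul_right)
      (fun x _ => hφ.1.differentiable (by simp) x) (fun x _ => hψ.differentiable (by simp) x),
    neg_neg]

end IsTest

/-! ### Integration by parts in Sobolev spaces -/

section Sobolev

variable {d : ℕ} {F H : Type*} [NormedAddCommGroup F] [NormedSpace ℝ F]
  [NormedAddCommGroup H] [NormedSpace ℝ H] {Ω : Set (EuclideanSpace ℝ (Fin d))}

theorem classicalGrad_apply (φ : EuclideanSpace ℝ (Fin d) → F) (x : EuclideanSpace ℝ (Fin d))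
    (j : Fin d) : classicalGrad φ x j = fderiv ℝ φ x (EuclideanSpace.single j 1) := rfl

theorem continuous_classicalGrad {φ : EuclideanSpace ℝ (Fin d) → F} (hφ : ContDiff ℝ ∞ φ) :
    Continuous (classicalGrad φ) :=
  (PiLp.continuous_toLp 2 _).comp
    (continuous_pi fun _ => (hφ.continuous_fderiv (by simp)).clm_apply continuous_const)

theorem classicalGrad_continuousLinearMap (L : EuclideanSpace ℝ (Fin d) →L[ℝ] F)
    (x : EuclideanSpace ℝ (Fin d)) (j : Fin d) :
    classicalGrad L x j = L (EuclideanSpace.single j 1) := by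
  rw [classicalGrad_apply, L.fderiv]

theorem classicalGrad_continuousLinearMap_comp (L : F →L[ℝ] H)
    {φ : EuclideanSpace ℝ (Fin d) → F} (hφ : ContDiff ℝ ∞ φ) (x : EuclideanSpace ℝ (Fin d))
    (j : Fin d) : classicalGrad (fun y => L (φ y)) x j = L (classicalGrad φ x j) := by
  have := (L.hasFDerivAt.comp x (hφ.differentiable (by simp) x).hasFDerivAt).fderiv
  exact congrArg (fun D => D (EuclideanSpace.single j 1)) this

theorem IsTest.hasCompactSupport_classicalGrad {φ : EuclideanSpace ℝ (Fin d) → F}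
    (hφ : IsTest Ω φ) : HasCompactSupport (classicalGrad φ) := by
  refine (hφ.2.1.fderiv ℝ).mono fun x hx hx0 => hx ?_
  ext j
  rw [classicalGrad_apply, hx0, PiLp.zero_apply, zero_apply]

theorem IsTest.memLp_classicalGrad {φ : EuclideanSpace ℝ (Fin d) → F} (hφ : IsTest Ω φ)
    (p : ENNReal) (m : Measure (EuclideanSpace ℝ (Fin d))) [IsFiniteMeasureOnCompacts m] :
    MemLp (classicalGrad φ) p m :=
  (continuous_classicalGrad hφ.1).memLp_of_hasCompactSupport hφ.hasCompactSupport_classicalGrad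

theorem tendsto_eLpNorm_grad_apply {α : Type*} [MeasurableSpace α] {m : Measure α} {p : ENNReal}
    {D : ℕ → α → Grad d F} {D' : α → Grad d F}
    (h : Tendsto (fun k => eLpNorm (D k - D') p m) atTop (𝓝 0)) (j : Fin d) :
    Tendsto (fun k => eLpNorm ((fun x => D k x j) - fun x => D' x j) p m) atTop (𝓝 0) :=
  tendsto_eLpNorm_comp_sub_comp (PiLp.proj (𝕜 := ℝ) 2 (fun _ : Fin d => F) j) h

theorem IsTest.integral_classicalGrad_smul {φ : EuclideanSpace ℝ (Fin d) → ℝ} (hφ : IsTest Ω φ)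
    {ψ : EuclideanSpace ℝ (Fin d) → F} (hψ : ContDiff ℝ ∞ ψ) (j : Fin d) :
    ∫ x in Ω, classicalGrad φ x j • ψ x = -∫ x in Ω, φ x • classicalGrad ψ x j :=
  hφ.integral_fderiv_smul volume hψ (EuclideanSpace.single j 1)

variable [CompleteSpace F]

theorem hasH1Grad_classicalGrad (hΩ : Bornology.IsBounded Ω) {ψ : EuclideanSpace ℝ (Fin d) → F}
    (hψ : ContDiff ℝ ∞ ψ) : HasH1Grad Ω ψ (classicalGrad ψ) :=
  ⟨memLp_restrict_of_continuous hΩ hψ.continuous,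
    memLp_restrict_of_continuous hΩ (continuous_classicalGrad hψ),
    fun _ hφ j => hφ.integral_classicalGrad_smul hψ j⟩

theorem hasH10Grad_of_tendsto {u : EuclideanSpace ℝ (Fin d) → F}
    {Du : EuclideanSpace ℝ (Fin d) → Grad d F}
    (hu : MemLp u 2 (volume.restrict Ω)) (hDu : MemLp Du 2 (volume.restrict Ω))
    {φ : ℕ → EuclideanSpace ℝ (Fin d) → F} (hφ : ∀ k, IsTest Ω (φ k))
    (h : Tendsto (fun k => eLpNorm (φ k - u) 2 (volume.restrict Ω)) atTop (𝓝 0))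
    (hD : Tendsto (fun k => eLpNorm (classicalGrad (φ k) - Du) 2 (volume.restrict Ω)) atTop (𝓝 0)) :
    HasH10Grad Ω u Du := by
  refine ⟨⟨hu, hDu, fun ψ hψ j => ?_⟩, φ, hφ, h, hD⟩
  have lim_grad := tendsto_integral_smul ((hψ.memLp_classicalGrad 2 _).eval_piLp j)
    (fun k => (hφ k).memLp 2 _) hu h
  have lim := tendsto_integral_smul (hψ.memLp 2 (volume.restrict Ω))
    (fun k => ((hφ k).memLp_classicalGrad 2 _).eval_piLp j) (hDu.eval_piLp j)
    (tendsto_eLpNorm_grad_apply hD j)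
  exact tendsto_nhds_unique lim_grad
    (lim.neg.congr fun k => (hψ.integral_classicalGrad_smul (hφ k).1 j).symm)

theorem HasH1Grad.integral_smul_isTest {ψ : EuclideanSpace ℝ (Fin d) → ℝ}
    {Dψ : EuclideanSpace ℝ (Fin d) → Grad d ℝ} (hψ : HasH1Grad Ω ψ Dψ)
    {φ : EuclideanSpace ℝ (Fin d) → F} (hφ : IsTest Ω φ) (j : Fin d) :
    ∫ x in Ω, Dψ x j • φ x = -∫ x in Ω, ψ x • classicalGrad φ x j := by
  refine (SeparatingDual.eq_iff_forall_dual_eq (R := ℝ)).2 fun L => ?_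
  rw [map_neg, ← L.integral_comp_comm
      (integrable_smul_of_memLp (hψ.2.1.eval_piLp j) (hφ.memLp 2 _)),
    ← L.integral_comp_comm
      (integrable_smul_of_memLp hψ.1 ((hφ.memLp_classicalGrad 2 _).eval_piLp j))]
  have := hψ.2.2 _ (hφ.comp_left L.contDiff L.map_zero) j
  simp only [classicalGrad_continuousLinearMap_comp L hφ.1, smul_eq_mul] at this
  simp only [L.map_smul, smul_eq_mul, mul_comm (ψ _), mul_comm (Dψ _ j)]
  rw [this, neg_neg]

theorem HasH10Grad.integral_smul {u : EuclideanSpace ℝ (Fin d) → F}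
    {Du : EuclideanSpace ℝ (Fin d) → Grad d F} (hu : HasH10Grad Ω u Du)
    {ψ : EuclideanSpace ℝ (Fin d) → ℝ} {Dψ : EuclideanSpace ℝ (Fin d) → Grad d ℝ}
    (hψ : HasH1Grad Ω ψ Dψ) (j : Fin d) :
    ∫ x in Ω, Dψ x j • u x = -∫ x in Ω, ψ x • Du x j := by
  obtain ⟨⟨hu, hDu, -⟩, φ, hφ, h, hD⟩ := hu
  have lim_grad := tendsto_integral_smul (hψ.2.1.eval_piLp j)
    (fun k => (hφ k).memLp 2 _) hu h
  have lim := tendsto_integral_smul hψ.1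
    (fun k => ((hφ k).memLp_classicalGrad 2 _).eval_piLp j) (hDu.eval_piLp j)
    (tendsto_eLpNorm_grad_apply hD j)
  exact tendsto_nhds_unique lim_grad
    (lim.neg.congr fun k => (hψ.integral_smul_isTest (hφ k) j).symm)

end Sobolev

/-! ### The Poincaré inequality -/

section Poincare

variable {d : ℕ} {F : Type*} [NormedAddCommGroup F] [InnerProductSpace ℝ F]
  {Ω : Set (EuclideanSpace ℝ (Fin d))}

theorem classicalGrad_norm_sq {φ : EuclideanSpace ℝ (Fin d) → F} (hφ : ContDiff ℝ ∞ φ)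
    (x : EuclideanSpace ℝ (Fin d)) (j : Fin d) :
    classicalGrad (fun y => ‖φ y‖ ^ 2) x j = 2 * ⟪φ x, classicalGrad φ x j⟫_ℝ := by
  rw [classicalGrad_apply, (hφ.differentiable (by simp) x).hasFDerivAt.norm_sq.fderiv]
  simp [classicalGrad_apply]

theorem IsTest.integral_norm_sq {φ : EuclideanSpace ℝ (Fin d) → F} (hφ : IsTest Ω φ) (j : Fin d) :
    ∫ x in Ω, ‖φ x‖ ^ 2 = ∫ x in Ω, ⟪φ x, (-2 * x j) • classicalGrad φ x j⟫_ℝ := by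
  have parts := (hφ.comp_left (contDiff_norm_sq ℝ) (by simp)).integral_classicalGrad_smul
    (EuclideanSpace.proj (𝕜 := ℝ) j).contDiff j
  simp only [classicalGrad_norm_sq hφ.1, classicalGrad_continuousLinearMap, PiLp.proj_apply,
    PiLp.single_apply, if_true, smul_eq_mul, mul_one] at parts
  rw [← neg_eq_iff_eq_neg.2 parts, ← integral_neg]
  congr 1 with x
  rw [inner_smul_right]
  ring

theorem IsTest.eLpNorm_le_eLpNorm_classicalGrad {φ : EuclideanSpace ℝ (Fin d) → F}
    (hφ : IsTest Ω φ) (hΩ : MeasurableSet Ω) (j : Fin d) {M : ℝ} (hM0 : 0 ≤ M)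
    (hM : ∀ x ∈ Ω, |x j| ≤ M) :
    (eLpNorm φ 2 (volume.restrict Ω)).toReal ≤
      2 * M * (eLpNorm (fun x => classicalGrad φ x j) 2 (volume.restrict Ω)).toReal := by
  set N := (eLpNorm φ 2 (volume.restrict Ω)).toReal
  have hφ2 := hφ.memLp 2 (volume.restrict Ω)
  have hdφ2 := (hφ.memLp_classicalGrad 2 (volume.restrict Ω)).eval_piLp j
  have weight : ∀ᵐ x ∂volume.restrict Ω,
      ‖(-2 * x j) • classicalGrad φ x j‖ ≤ 2 * M * ‖classicalGrad φ x j‖ := by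
    refine ae_restrict_of_forall_mem hΩ fun x hx => ?_
    rw [norm_smul, norm_mul, norm_neg, Real.norm_two, Real.norm_eq_abs]
    gcongr
    exact hM x hx
  have hweight2 : MemLp (fun x => (-2 * x j) • classicalGrad φ x j) 2 (volume.restrict Ω) :=
    hdφ2.of_le_mul
      (((continuous_const.mul (EuclideanSpace.proj (𝕜 := ℝ) j).continuous).smul
        ((hφ.1.continuous_fderiv (by simp)).clm_apply continuous_const)).aestronglyMeasurable)
      weight
  have square : N ^ 2 ≤
      N * (2 * M * (eLpNorm (fun x => classicalGrad φ x j) 2 (volume.restrict Ω)).toReal) := calc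
    N ^ 2 = ∫ x in Ω, ⟪φ x, (-2 * x j) • classicalGrad φ x j⟫_ℝ := by
      rw [← hφ.integral_norm_sq, ← integral_inner_self_eq_eLpNorm_sq hφ2]
      simp only [real_inner_self_eq_norm_sq]
    _ ≤ N * (eLpNorm (fun x => (-2 * x j) • classicalGrad φ x j) 2 (volume.restrict Ω)).toReal :=
      integral_inner_le_eLpNorm_mul_eLpNorm hφ2 hweight2
    _ ≤ _ := by
      gcongr
      rw [← ENNReal.toReal_ofReal (by positivity : 0 ≤ 2 * M), ← ENNReal.toReal_mul]
      exact ENNReal.toReal_mono (ENNReal.mul_ne_top ENNReal.ofReal_ne_top hdφ2.2.ne)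
        (eLpNorm_le_mul_eLpNorm_of_ae_le_mul weight 2)
  have bound_nonneg :
      0 ≤ 2 * M * (eLpNorm (fun x => classicalGrad φ x j) 2 (volume.restrict Ω)).toReal := by
    positivity
  by_contra! hlt
  nlinarith

theorem HasH10Grad.eLpNorm_le_eLpNorm_grad [CompleteSpace F]
    {u : EuclideanSpace ℝ (Fin d) → F} {Du : EuclideanSpace ℝ (Fin d) → Grad d F}
    (hu : HasH10Grad Ω u Du) (hΩ : MeasurableSet Ω) (j : Fin d) {M : ℝ} (hM0 : 0 ≤ M)
    (hM : ∀ x ∈ Ω, |x j| ≤ M) :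
    (eLpNorm u 2 (volume.restrict Ω)).toReal ≤
      2 * M * (eLpNorm (fun x => Du x j) 2 (volume.restrict Ω)).toReal := by
  obtain ⟨⟨hu, hDu, -⟩, φ, hφ, h, hD⟩ := hu
  exact le_of_tendsto_of_tendsto' (tendsto_toReal_eLpNorm (fun k => (hφ k).memLp 2 _) hu h)
    ((tendsto_toReal_eLpNorm (fun k => ((hφ k).memLp_classicalGrad 2 _).eval_piLp j)
      (hDu.eval_piLp j) (tendsto_eLpNorm_grad_apply hD j)).const_mul (2 * M))
    fun k => (hφ k).eLpNorm_le_eLpNorm_classicalGrad hΩ j hM0 hM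

end Poincare

/-! ### Functions on a product as `Lᵖ`-valued functions -/

theorem measurable_of_measurable_edist {α X : Type*} [MeasurableSpace α] [PseudoEMetricSpace X]
    [SecondCountableTopology X] [MeasurableSpace X] [BorelSpace X] {f : α → X}
    (hf : ∀ c, Measurable fun t => edist (f t) c) : Measurable f := by
  refine measurable_of_isOpen fun U hU => ?_
  choose r hr hrU using fun c : U => EMetric.isOpen_iff.1 hU c c.2
  obtain ⟨T, hT, hTU⟩ := TopologicalSpace.isOpen_iUnion_countable
    (fun c : U => Metric.eball (c : X) (r c)) fun c => Metric.isOpen_eball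
  have cover : U = ⋃ c ∈ T, Metric.eball (c : X) (r c) := by
    rw [hTU]
    exact Set.Subset.antisymm
      (fun x hx => Set.mem_iUnion.2 ⟨⟨x, hx⟩, Metric.mem_eball_self (hr _)⟩)
      (Set.iUnion_subset hrU)
  rw [cover, Set.preimage_iUnion₂]
  exact MeasurableSet.biUnion hT fun c _ => measurableSet_lt (hf c) measurable_const

section Curry

variable {α β F : Type*} [MeasurableSpace α] [MeasurableSpace β] [NormedAddCommGroup F]
  {ν : Measure α} {m : Measure β} {p : ENNReal}

theorem eLpNorm_rpow_toReal (hp0 : p ≠ 0) (hp : p ≠ ⊤) (m : Measure β) (f : β → F) :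
    eLpNorm f p m ^ p.toReal = ∫⁻ x, ‖f x‖ₑ ^ p.toReal ∂m := by
  rw [eLpNorm_eq_lintegral_rpow_enorm_toReal hp0 hp, ← ENNReal.rpow_mul,
    one_div_mul_cancel (ENNReal.toReal_ne_zero.2 ⟨hp0, hp⟩), ENNReal.rpow_one]

open Classical in
/-- The slice `w(t, ·)` of a function of two variables, as an element of `Lᵖ`. It is `0` when
`w(t, ·)` is not in `Lᵖ`. -/
def slice (p : ENNReal) (m : Measure β) (w : α × β → F) (t : α) : Lp F p m :=
  if h : MemLp (fun x => w (t, x)) p m then h.toLp _ else 0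

omit [MeasurableSpace α] in
theorem coeFn_slice {w : α × β → F} {t : α} (h : MemLp (fun x => w (t, x)) p m) :
    slice p m w t =ᵐ[m] fun x => w (t, x) := by
  rw [slice, dif_pos h]
  exact h.coeFn_toLp

variable [SFinite m]

theorem measurable_eLpNorm_slice (hp0 : p ≠ 0) (hp : p ≠ ⊤) {w : α × β → F}
    (hw : StronglyMeasurable w) : Measurable fun t => eLpNorm (fun x => w (t, x)) p m := by
  simp only [eLpNorm_eq_lintegral_rpow_enorm_toReal hp0 hp]
  exact (hw.enorm.pow_const _).lintegral_prod_right'.pow_const _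

theorem ae_memLp_slice (hp0 : p ≠ 0) (hp : p ≠ ⊤) {w : α × β → F} (hw : MemLp w p (ν.prod m)) :
    ∀ᵐ t ∂ν, MemLp (fun x => w (t, x)) p m := by
  have finite : ∫⁻ t, ∫⁻ x, ‖w (t, x)‖ₑ ^ p.toReal ∂m ∂ν ≠ ⊤ := by
    rw [← lintegral_prod _ (hw.1.enorm.pow_const _), ← eLpNorm_rpow_toReal hp0 hp (ν.prod m) w]
    exact ENNReal.rpow_ne_top_of_nonneg ENNReal.toReal_nonneg hw.2.ne
  filter_upwards [hw.1.prodMk_left,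
    ae_lt_top' (hw.1.enorm.pow_const _).lintegral_prod_right' finite] with t hmeas hlt
  exact ⟨hmeas, (eLpNorm_lt_top_iff_lintegral_rpow_enorm_lt_top hp0 hp).2 hlt⟩

theorem eLpNorm_curry (hp0 : p ≠ 0) (hp : p ≠ ⊤) {W : α → Lp F p m} {w : α × β → F}
    (hw : AEStronglyMeasurable w (ν.prod m)) (hWw : ∀ᵐ t ∂ν, ∀ᵐ x ∂m, W t x = w (t, x)) :
    eLpNorm W p ν = eLpNorm w p (ν.prod m) := by
  rw [eLpNorm_eq_lintegral_rpow_enorm_toReal hp0 hp, eLpNorm_eq_lintegral_rpow_enorm_toReal hp0 hp,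
    lintegral_prod _ (hw.enorm.pow_const _)]
  congr 1
  refine lintegral_congr_ae ?_
  filter_upwards [hWw] with t ht
  rw [Lp.enorm_def, eLpNorm_rpow_toReal hp0 hp]
  refine lintegral_congr_ae ?_
  filter_upwards [ht] with x hx
  rw [hx]

theorem stronglyMeasurable_slice [Fact (1 ≤ p)] [SecondCountableTopology (Lp F p m)] (hp : p ≠ ⊤)
    {w : α × β → F} (hw : StronglyMeasurable w) : StronglyMeasurable (slice p m w) := by
  classical
  let _ : MeasurableSpace (Lp F p m) := borel _
  have _ : BorelSpace (Lp F p m) := ⟨rfl⟩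
  have hp0 : p ≠ 0 := (zero_lt_one.trans_le Fact.out).ne'
  have hmeas : ∀ t, AEStronglyMeasurable (fun x => w (t, x)) m :=
    fun t => (hw.comp_measurable measurable_prodMk_left).aestronglyMeasurable
  refine (measurable_of_measurable_edist fun c => ?_).stronglyMeasurable
  have edist_slice : (fun t => edist (slice p m w t) c) = fun t =>
      if eLpNorm (fun x => w (t, x)) p m < ⊤ then eLpNorm (fun x => w (t, x) - c x) p m
      else edist 0 c := by
    ext t
    split_ifs with h
    · rw [Lp.edist_def]
      exact eLpNorm_congr_ae ((coeFn_slice ⟨hmeas t, h⟩).sub (ae_eq_refl _))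
    · rw [slice, dif_neg fun h' => h h'.2]
  rw [edist_slice]
  exact Measurable.ite (measurableSet_lt (measurable_eLpNorm_slice hp0 hp hw) measurable_const)
    (measurable_eLpNorm_slice (w := fun z => w z - c z.2) hp0 hp
      (hw.sub ((Lp.stronglyMeasurable c).comp_measurable measurable_snd))) measurable_const

theorem exists_curry [Fact (1 ≤ p)] [SecondCountableTopology (Lp F p m)] (hp : p ≠ ⊤)
    {w : α × β → F} (hw : MemLp w p (ν.prod m)) :
    ∃ W : Lp (Lp F p m) p ν, ∀ᵐ t ∂ν, ∀ᵐ x ∂m, W t x = w (t, x) := by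
  have hp0 : p ≠ 0 := (zero_lt_one.trans_le Fact.out).ne'
  obtain ⟨w', hw', hww'⟩ := hw.1
  have hslice : ∀ᵐ t ∂ν, ∀ᵐ x ∂m, slice p m w' t x = w (t, x) := by
    filter_upwards [ae_memLp_slice hp0 hp (hw.ae_eq hww'), Measure.ae_ae_of_ae_prod hww']
      with t hmem ht
    filter_upwards [coeFn_slice hmem, ht] with x hx hx'
    rw [hx, hx']
  have hmem : MemLp (slice p m w') p ν :=
    ⟨(stronglyMeasurable_slice hp hw').aestronglyMeasurable, by
      rw [eLpNorm_curry hp0 hp hw.1 hslice]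
      exact hw.2⟩
  refine ⟨hmem.toLp _, ?_⟩
  filter_upwards [hslice, hmem.coeFn_toLp] with t ht hcoe
  rwa [hcoe]

theorem memLp_mul_prod (hp0 : p ≠ 0) (hp : p ≠ ⊤) {a : α → ℝ} {b : β → ℝ}
    (ha : MemLp a p ν) (hb : MemLp b p m) :
    MemLp (fun z : α × β => a z.1 * b z.2) p (ν.prod m) := by
  refine ⟨ha.1.comp_fst.mul hb.1.comp_snd,
    (eLpNorm_lt_top_iff_lintegral_rpow_enorm_lt_top hp0 hp).2 ?_⟩
  simp only [enorm_mul, ENNReal.mul_rpow_of_nonneg _ _ ENNReal.toReal_nonneg]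
  rw [lintegral_prod_mul (ha.1.enorm.pow_const _) (hb.1.enorm.pow_const _)]
  exact ENNReal.mul_lt_top
    ((eLpNorm_lt_top_iff_lintegral_rpow_enorm_lt_top hp0 hp).1 ha.2)
    ((eLpNorm_lt_top_iff_lintegral_rpow_enorm_lt_top hp0 hp).1 hb.2)

theorem smulIntegral_smulIntegral [SFinite ν] [NormedSpace ℝ F] [CompleteSpace F] {q : ENNReal}
    [p.HolderConjugate q] [Fact (1 ≤ p)] [Fact (1 ≤ q)] (hp : p ≠ ⊤)
    {W : Lp (Lp F q m) q ν} {w : α × β → F} (hw : MemLp w q (ν.prod m))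
    (hWw : ∀ᵐ t ∂ν, ∀ᵐ x ∂m, W t x = w (t, x)) {a : α → ℝ} {b : β → ℝ}
    (ha : MemLp a p ν) (hb : MemLp b p m) :
    smulIntegral hb (smulIntegral ha W) = ∫ z, (a z.1 * b z.2) • w z ∂(ν.prod m) := by
  have hp0 : p ≠ 0 := (zero_lt_one.trans_le Fact.out).ne'
  rw [smulIntegral_apply ha,
    ← (smulIntegral hb).integral_comp_comm (integrable_smul_of_memLp ha (Lp.memLp W)),
    integral_prod _ (integrable_smul_of_memLp (memLp_mul_prod hp0 hp ha hb) hw)]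
  refine integral_congr_ae ?_
  filter_upwards [hWw] with t ht
  simp only [map_smul, mul_smul]
  rw [smulIntegral_apply, integral_smul]
  congr 1
  refine integral_congr_ae ?_
  filter_upwards [ht] with x hx
  rw [hx]

end Curry

/-! ### Cylinders over the unit square -/

@[simp] theorem hat_apply_zero (x : E3) : hat x 0 = x 0 := rfl

@[simp] theorem hat_apply_one (x : E3) : hat x 1 = x 1 := rfl

@[simp] theorem hat_join (x : E2) (t : ℝ) : hat (join x t) = x := by
  ext i
  fin_cases i <;> rfl

@[simp] theorem join_apply_two (x : E2) (t : ℝ) : join x t 2 = t := rfl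

theorem join_hat (x : E3) : join (hat x) (x 2) = x := by
  ext i
  fin_cases i <;> rfl

/-- The identification of `ℝ × ℝ²` with `ℝ³`, the first factor being the vertical axis. -/
def joinEquiv : (ℝ × E2) ≃L[ℝ] E3 :=
  LinearEquiv.toContinuousLinearEquiv
    { toFun := fun z => join z.2 z.1
      map_add' := fun z w => by ext i; fin_cases i <;> simp [join]
      map_smul' := fun c z => by ext i; fin_cases i <;> simp [join]
      invFun := fun x => (x 2, hat x)
      left_inv := fun z => by simp
      right_inv := fun x => join_hat x }

@[simp] theorem joinEquiv_apply (z : ℝ × E2) : joinEquiv z = join z.2 z.1 := rfl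

theorem measurableEmbedding_joinEquiv : MeasurableEmbedding joinEquiv :=
  joinEquiv.toHomeomorph.measurableEmbedding

theorem measurePreserving_joinEquiv :
    MeasurePreserving joinEquiv ((volume : Measure ℝ).prod (volume : Measure E2)) volume := by
  have flatten :=
    (MeasurePreserving.id (volume : Measure ℝ)).prod (PiLp.volume_preserving_ofLp (Fin 2))
  have append := (volume_preserving_piFinSuccAbove (fun _ : Fin 3 => ℝ) (Fin.last 2)).symm
  have factor : (joinEquiv : ℝ × E2 → E3) = fun z => WithLp.toLp 2
      ((MeasurableEquiv.piFinSuccAbove (fun _ : Fin 3 => ℝ) (Fin.last 2)).symm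
        (Prod.map id WithLp.ofLp z)) := by
    refine funext fun z => PiLp.ext fun i => ?_
    fin_cases i <;> rfl
  rw [factor]
  exact (PiLp.volume_preserving_toLp (Fin 3)).comp (append.comp flatten)

theorem preimage_joinEquiv_fixedDomain (h : ℝ) :
    joinEquiv ⁻¹' fixedDomain h = Set.Ioo 0 h ×ˢ omega := by
  ext z
  simp only [Set.mem_preimage, fixedDomain, Set.mem_ofPred_eq, joinEquiv_apply, hat_join,
    join_apply_two, Set.mem_prod, Set.mem_Ioo]
  tauto

theorem isOpen_omega : IsOpen omega := by
  simp only [omega, Set.ofPred_forall]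
  refine isOpen_iInter_of_finite fun i => ?_
  have hi : Continuous fun x : E2 => x i := (EuclideanSpace.proj (𝕜 := ℝ) i).continuous
  exact (isOpen_lt continuous_const hi).inter (isOpen_lt hi continuous_const)

theorem isBounded_omega : Bornology.IsBounded omega :=
  ((PiLp.antilipschitzWith_ofLp 2 fun _ : Fin 2 => ℝ).isBounded_preimage
    (Metric.isBounded_Icc 0 1)).subset fun _ hx => ⟨fun i => (hx i).1.le, fun i => (hx i).2.le⟩

instance : IsFiniteMeasure (volume.restrict omega) :=
  isFiniteMeasure_restrict.2 isBounded_omega.measure_lt_top.ne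

theorem isOpen_fixedDomain (h : ℝ) : IsOpen (fixedDomain h) := by
  have hvert : Continuous fun x : E3 => x 2 := (EuclideanSpace.proj (𝕜 := ℝ) (2 : Fin 3)).continuous
  exact (isOpen_omega.preimage hat.continuous).inter
    ((isOpen_lt continuous_const hvert).inter (isOpen_lt hvert continuous_const))

theorem measurePreserving_joinEquiv_fixedDomain (h : ℝ) :
    MeasurePreserving joinEquiv
      ((volume.restrict (Set.Ioo 0 h)).prod (volume.restrict omega))
      (volume.restrict (fixedDomain h)) := by
  rw [Measure.prod_restrict, ← preimage_joinEquiv_fixedDomain]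
  exact measurePreserving_joinEquiv.restrict_preimage_emb measurableEmbedding_joinEquiv _

theorem integral_fixedDomain {F : Type*} [NormedAddCommGroup F] [NormedSpace ℝ F] (h : ℝ)
    (f : E3 → F) :
    ∫ x in fixedDomain h, f x =
      ∫ z, f (join z.2 z.1) ∂(volume.restrict (Set.Ioo 0 h)).prod (volume.restrict omega) :=
  ((measurePreserving_joinEquiv_fixedDomain h).integral_comp measurableEmbedding_joinEquiv f).symm

theorem memLp_fixedDomain_iff {F : Type*} [NormedAddCommGroup F] {p : ENNReal} {h : ℝ}
    {f : E3 → F} :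
    MemLp f p (volume.restrict (fixedDomain h)) ↔
      MemLp (fun z : ℝ × E2 => f (join z.2 z.1)) p
        ((volume.restrict (Set.Ioo 0 h)).prod (volume.restrict omega)) := by
  rw [← (measurePreserving_joinEquiv_fixedDomain h).map_eq,
    measurableEmbedding_joinEquiv.memLp_map_measure_iff]
  rfl

instance : SecondCountableTopology L2omega3 := by
  have : Fact ((2 : ENNReal) ≠ ⊤) := ⟨by simp⟩
  exact Lp.SecondCountableTopology

section Tensor

variable {F : Type*} [NormedAddCommGroup F] [NormedSpace ℝ F] {h : ℝ}

theorem contDiff_join_left (t : ℝ) : ContDiff ℝ ∞ fun y : E2 => join y t :=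
  joinEquiv.contDiff.comp (contDiff_prodMk_right t)

theorem contDiff_join_right (y : E2) : ContDiff ℝ ∞ fun t : ℝ => join y t :=
  joinEquiv.contDiff.comp (contDiff_prodMk_left y)

theorem IsTest.comp_join_left {φ : E3 → F} (hφ : IsTest (fixedDomain h) φ) (t : ℝ) :
    IsTest omega fun y => φ (join y t) :=
  hφ.comp_of_leftInverse (contDiff_join_left t) hat.continuous (fun y => hat_join y t)
    fun y hy => hat_join y t ▸ hy.1

theorem IsTest.comp_join_right {φ : E3 → F} (hφ : IsTest (fixedDomain h) φ) (y : E2) :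
    IsTest (Set.Ioo 0 h) fun t => φ (join y t) :=
  hφ.comp_of_leftInverse (contDiff_join_right y)
    (EuclideanSpace.proj (𝕜 := ℝ) (2 : Fin 3)).continuous (join_apply_two y) fun _ ht => ht.2

theorem classicalGrad_comp_join_left {φ : E3 → F} (hφ : ContDiff ℝ ∞ φ) (t : ℝ) (y : E2)
    (j : Fin 2) :
    classicalGrad (fun y => φ (join y t)) y j = classicalGrad φ (join y t) j.castSucc := by
  have chain := ((hφ.differentiable (by simp) (joinEquiv (t, y))).hasFDerivAt.comp y
    (joinEquiv.hasFDerivAt.comp y (hasFDerivAt_prodMk_right (𝕜 := ℝ) t y))).fderiv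
  refine (congrArg (fun D => D (EuclideanSpace.single j 1)) chain).trans ?_
  refine congrArg (fderiv ℝ φ (join y t)) (PiLp.ext fun i => ?_)
  fin_cases j <;> fin_cases i <;> simp [join]

theorem fderiv_comp_join_right {φ : E3 → F} (hφ : ContDiff ℝ ∞ φ) (y : E2) (t : ℝ) :
    fderiv ℝ (fun t => φ (join y t)) t 1 = classicalGrad φ (join y t) 2 := by
  have chain := ((hφ.differentiable (by simp) (joinEquiv (t, y))).hasFDerivAt.comp t
    (joinEquiv.hasFDerivAt.comp t (hasFDerivAt_prodMk_left (𝕜 := ℝ) t y))).fderiv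
  refine (congrArg (fun D => D 1) chain).trans ?_
  refine congrArg (fderiv ℝ φ (join y t)) (PiLp.ext fun i => ?_)
  fin_cases i <;> simp [join]

theorem integral_fixedDomain_eq_integral_horizontal {f : E3 → F}
    (hf : IntegrableOn f (fixedDomain h)) :
    ∫ x in fixedDomain h, f x = ∫ t in Set.Ioo 0 h, ∫ y in omega, f (join y t) := by
  rw [integral_fixedDomain, integral_prod]
  exact memLp_one_iff_integrable.1 (memLp_fixedDomain_iff.1 (memLp_one_iff_integrable.2 hf))

theorem integral_fixedDomain_eq_integral_vertical {f : E3 → F}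
    (hf : IntegrableOn f (fixedDomain h)) :
    ∫ x in fixedDomain h, f x = ∫ y in omega, ∫ t in Set.Ioo 0 h, f (join y t) := by
  rw [integral_fixedDomain, integral_prod_symm]
  exact memLp_one_iff_integrable.1 (memLp_fixedDomain_iff.1 (memLp_one_iff_integrable.2 hf))

theorem memLp_mul_fixedDomain {a : ℝ → ℝ} {b : E2 → ℝ}
    (ha : MemLp a 2 (volume.restrict (Set.Ioo 0 h))) (hb : MemLp b 2 (volume.restrict omega)) :
    MemLp (fun x => a (x 2) * b (hat x)) 2 (volume.restrict (fixedDomain h)) :=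
  memLp_fixedDomain_iff.2 (by simpa using memLp_mul_prod (by simp) (by simp) ha hb)

omit [NormedSpace ℝ F] in
theorem memLp_Ioo {a : ℝ → F} (ha : Continuous a) (c d : ℝ) (p : ENNReal) :
    MemLp a p (volume.restrict (Set.Ioo c d)) :=
  memLp_restrict_of_continuous (Metric.isBounded_Ioo c d) ha

/-- The gradient of the product `a(x₃) b(x̂)` of two functions of separate variables, `Db` being
the gradient of `b`. -/
def tensorGrad (a : ℝ → ℝ) (b : E2 → ℝ) (Db : E2 → Grad 2 ℝ) (x : E3) : Grad 3 ℝ :=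
  !₂[a (x 2) * Db (hat x) 0, a (x 2) * Db (hat x) 1, deriv a (x 2) * b (hat x)]

variable {a : ℝ → ℝ} {b : E2 → ℝ} {Db : E2 → Grad 2 ℝ} {φ : E3 → ℝ}

theorem memLp_tensorGrad (ha : ContDiff ℝ ∞ a) (hb : HasH1Grad omega b Db) :
    MemLp (tensorGrad a b Db) 2 (volume.restrict (fixedDomain h)) := by
  refine MemLp.of_eval_piLp fun j => ?_
  have ha2 := memLp_Ioo ha.continuous 0 h 2
  fin_cases j
  · exact memLp_mul_fixedDomain ha2 (hb.2.1.eval_piLp 0)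
  · exact memLp_mul_fixedDomain ha2 (hb.2.1.eval_piLp 1)
  · exact memLp_mul_fixedDomain (memLp_Ioo (ha.continuous_deriv (by simp)) 0 h 2) hb.1

theorem integral_grad_castSucc_smul_mul (hφ : IsTest (fixedDomain h) φ)
    (ha : Continuous a) (hb : HasH1Grad omega b Db) (j : Fin 2) :
    ∫ x in fixedDomain h, classicalGrad φ x j.castSucc • (a (x 2) * b (hat x)) =
      -∫ x in fixedDomain h, φ x • (a (x 2) * Db (hat x) j) := by
  have ha2 := memLp_Ioo ha 0 h 2
  rw [integral_fixedDomain_eq_integral_horizontal (integrable_smul_of_memLp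
      ((hφ.memLp_classicalGrad 2 _).eval_piLp _) (memLp_mul_fixedDomain ha2 hb.1)),
    integral_fixedDomain_eq_integral_horizontal (integrable_smul_of_memLp
      (hφ.memLp 2 _) (memLp_mul_fixedDomain ha2 (hb.2.1.eval_piLp j))), ← integral_neg]
  congr 1 with t
  have parts := hb.2.2 _ (hφ.comp_join_left t) j
  simp only [classicalGrad_comp_join_left hφ.1, smul_eq_mul] at parts
  simp only [hat_join, join_apply_two, smul_eq_mul, mul_left_comm _ (a t), integral_const_mul,
    parts, mul_neg]

theorem integral_grad_two_smul_mul (hφ : IsTest (fixedDomain h) φ)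
    (ha : ContDiff ℝ ∞ a) (hb : MemLp b 2 (volume.restrict omega)) :
    ∫ x in fixedDomain h, classicalGrad φ x 2 • (a (x 2) * b (hat x)) =
      -∫ x in fixedDomain h, φ x • (deriv a (x 2) * b (hat x)) := by
  rw [integral_fixedDomain_eq_integral_vertical (integrable_smul_of_memLp
      ((hφ.memLp_classicalGrad 2 _).eval_piLp 2)
      (memLp_mul_fixedDomain (memLp_Ioo ha.continuous 0 h 2) hb)),
    integral_fixedDomain_eq_integral_vertical (integrable_smul_of_memLp (hφ.memLp 2 _)
      (memLp_mul_fixedDomain (memLp_Ioo (ha.continuous_deriv (by simp)) 0 h 2) hb)), ← integral_neg]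
  congr 1 with y
  have parts := (hφ.comp_join_right y).integral_fderiv_smul volume ha 1
  simp only [fderiv_comp_join_right hφ.1, fderiv_apply_one_eq_deriv, smul_eq_mul] at parts
  simp only [hat_join, join_apply_two, smul_eq_mul, ← mul_assoc, integral_mul_const, parts, neg_mul]

theorem HasH1Grad.tensor (ha : ContDiff ℝ ∞ a) (hb : HasH1Grad omega b Db) :
    HasH1Grad (fixedDomain h) (fun x => a (x 2) * b (hat x)) (tensorGrad a b Db) := by
  refine ⟨memLp_mul_fixedDomain (memLp_Ioo ha.continuous 0 h 2) hb.1, memLp_tensorGrad ha hb,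
    fun φ hφ j => ?_⟩
  fin_cases j
  · exact integral_grad_castSucc_smul_mul hφ ha.continuous hb 0
  · exact integral_grad_castSucc_smul_mul hφ ha.continuous hb 1
  · exact integral_grad_two_smul_mul hφ ha hb.1

end Tensor

/-! ### Weak convergence -/

section WeakConvergence

theorem weakTendsto_iff {E : Type*} [NormedAddCommGroup E] [NormedSpace ℝ E] {x : ℕ → E} {a : E} :
    WeakTendsto x a ↔ ∀ l : StrongDual ℝ E, Tendsto (fun n => l (x n)) atTop (𝓝 (l a)) := by
  have inducing : Topology.IsInducing fun (x : WeakSpace ℝ E) (y : StrongDual ℝ E) =>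
    (topDualPairing ℝ E).flip x y := ⟨rfl⟩
  rw [WeakTendsto, inducing.tendsto_nhds_iff, tendsto_pi_nhds]
  rfl

theorem WeakTendsto.continuousLinearMap {E F : Type*} [NormedAddCommGroup E] [NormedSpace ℝ E]
    [NormedAddCommGroup F] [NormedSpace ℝ F] {x : ℕ → E} {a : E} (h : WeakTendsto x a)
    (L : E →L[ℝ] F) : WeakTendsto (fun n => L (x n)) (L a) :=
  weakTendsto_iff.2 fun l => weakTendsto_iff.1 h (l.comp L)

variable {H : Type*} [NormedAddCommGroup H] [InnerProductSpace ℝ H] [CompleteSpace H]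

theorem weakTendsto_iff_inner {x : ℕ → H} {a : H} :
    WeakTendsto x a ↔ ∀ y, Tendsto (fun n => ⟪x n, y⟫_ℝ) atTop (𝓝 ⟪a, y⟫_ℝ) := by
  rw [weakTendsto_iff, (InnerProductSpace.toDual ℝ H).surjective.forall]
  simp only [InnerProductSpace.toDual_apply_apply, real_inner_comm]

theorem exists_weakTendsto_of_separableSpace [TopologicalSpace.SeparableSpace H] {x : ℕ → H}
    {R : ℝ} (hx : ∀ n, ‖x n‖ ≤ R) :
    ∃ (s : ℕ → ℕ) (a : H), StrictMono s ∧ WeakTendsto (fun k => x (s k)) a := by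
  have bounded : ∀ n, StrongDual.toWeakDual (InnerProductSpace.toDual ℝ H (x n)) ∈
      WeakDual.toStrongDual ⁻¹' Metric.closedBall (0 : StrongDual ℝ H) R := fun n =>
    mem_closedBall_zero_iff.2 <| ((InnerProductSpace.toDual ℝ H).norm_map (x n)).trans_le (hx n)
  obtain ⟨l, -, s, hs, hl⟩ := WeakDual.isSeqCompact_closedBall ℝ H 0 R bounded
  obtain ⟨a, ha⟩ := (InnerProductSpace.toDual ℝ H).surjective (WeakDual.toStrongDual l)
  rw [tendsto_iff_forall_eval_tendsto_topDualPairing] at hl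
  have limit : ∀ y, topDualPairing ℝ H l y = ⟪a, y⟫_ℝ :=
    fun y => congrArg (fun f : StrongDual ℝ H => f y) ha.symm
  exact ⟨s, a, hs, weakTendsto_iff_inner.2 fun y => limit y ▸ hl y⟩

theorem exists_weakTendsto_of_bounded {x : ℕ → H} {R : ℝ} (hx : ∀ n, ‖x n‖ ≤ R) :
    ∃ (s : ℕ → ℕ) (a : H), StrictMono s ∧ WeakTendsto (fun k => x (s k)) a := by
  set M : Submodule ℝ H := (Submodule.span ℝ (Set.range x)).topologicalClosure with hM
  have : CompleteSpace M := (Submodule.isClosed_topologicalClosure _).completeSpace_coe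
  have separable : TopologicalSpace.IsSeparable (M : Set H) := by
    rw [hM, Submodule.topologicalClosure_coe]
    exact ((Set.countable_range x).isSeparable.span (R := ℝ)).closure
  have : TopologicalSpace.SeparableSpace M := separable.separableSpace
  obtain ⟨s, a, hs, ha⟩ := exists_weakTendsto_of_separableSpace (H := M) (x := fun n =>
    ⟨x n, Submodule.le_topologicalClosure _ (Submodule.subset_span ⟨n, rfl⟩)⟩) hx
  exact ⟨s, a, hs, ha.continuousLinearMap M.subtypeL⟩

end WeakConvergence

section H1

variable {a b : ℝ} {X : Type*} [NormedAddCommGroup X] [NormedSpace ℝ X] [CompleteSpace X]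

theorem mem_H1_iff {p : WithLp 2 (Lp X 2 (volume.restrict (Set.Ioo a b)) ×
      Lp X 2 (volume.restrict (Set.Ioo a b)))} :
    p ∈ H1 a b X ↔ ∀ (φ : ℝ → ℝ) (hφ : IsTest (Set.Ioo a b) φ),
      smulIntegral (hφ.deriv.memLp 2 _) p.fst = -smulIntegral (hφ.memLp 2 _) p.snd := by
  simp only [smulIntegral_apply]
  rfl

theorem isClosed_H1 : IsClosed (H1 a b X : Set (WithLp 2 (Lp X 2 (volume.restrict (Set.Ioo a b)) ×
      Lp X 2 (volume.restrict (Set.Ioo a b))))) := by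
  have inter : (H1 a b X : Set (WithLp 2 (Lp X 2 (volume.restrict (Set.Ioo a b)) ×
      Lp X 2 (volume.restrict (Set.Ioo a b))))) =
      ⋂ (φ : ℝ → ℝ) (hφ : IsTest (Set.Ioo a b) φ),
        {p | smulIntegral (hφ.deriv.memLp 2 _) p.fst = -smulIntegral (hφ.memLp 2 _) p.snd} := by
    ext p
    simp only [SetLike.mem_coe, mem_H1_iff, Set.mem_iInter, Set.mem_ofPred_eq]
  rw [inter]
  exact isClosed_iInter fun φ => isClosed_iInter fun hφ => isClosed_eq
    ((smulIntegral _).continuous.comp (WithLp.fstL 2 ℝ _ _).continuous)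
    ((smulIntegral _).continuous.comp (WithLp.sndL 2 ℝ _ _).continuous).neg

instance : CompleteSpace (H1 a b X) := isClosed_H1.completeSpace_coe

/-- The inclusion of `H¹((a, b); X)` in `L²((a, b); X)`. -/
def h1ToLp : H1 a b X →L[ℝ] Lp X 2 (volume.restrict (Set.Ioo a b)) :=
  (WithLp.fstL 2 ℝ _ _).comp (H1 a b X).subtypeL

theorem norm_le_add_norm {α β : Type*} [NormedAddCommGroup α] [NormedAddCommGroup β]
    (p : WithLp 2 (α × β)) : ‖p‖ ≤ ‖p.fst‖ + ‖p.snd‖ := by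
  rw [WithLp.prod_norm_eq_of_L2]
  refine Real.sqrt_le_iff.2 ⟨by positivity, ?_⟩
  nlinarith [norm_nonneg p.fst, norm_nonneg p.snd]

end H1

section FundamentalLemma

variable {E F H : Type*} [NormedAddCommGroup E] [NormedSpace ℝ E] [FiniteDimensional ℝ E]
  [MeasurableSpace E] [BorelSpace E] [NormedAddCommGroup F] [NormedSpace ℝ F]
  [NormedAddCommGroup H] [NormedSpace ℝ H] {m : Measure E} [IsFiniteMeasureOnCompacts m]
  {Ω : Set E} {q : ENNReal} {u : E → F}

omit [BorelSpace E] [NormedSpace ℝ F] in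
theorem locallyIntegrableOn_of_memLp_restrict (hΩ : IsOpen Ω) (hu : MemLp u q (m.restrict Ω))
    (hq : 1 ≤ q) : LocallyIntegrableOn u Ω m := fun x hx => by
  have : ProperSpace E := FiniteDimensional.proper ℝ E
  obtain ⟨K, hK, hxK, hKΩ⟩ := exists_compact_subset hΩ hx
  have : IsFiniteMeasure (m.restrict K) := isFiniteMeasure_restrict.2 hK.measure_lt_top.ne
  exact ⟨K, mem_nhdsWithin_of_mem_nhds (mem_interior_iff_mem_nhds.1 hxK),
    (hu.mono_measure (Measure.restrict_mono_set _ hKΩ)).integrable hq⟩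

theorem ae_eq_zero_of_integral_isTest_smul [CompleteSpace F] (hΩ : IsOpen Ω)
    (hu : MemLp u q (m.restrict Ω)) (hq : 1 ≤ q)
    (h : ∀ η : E → ℝ, IsTest Ω η → ∫ x in Ω, η x • u x ∂m = 0) :
    ∀ᵐ x ∂m.restrict Ω, u x = 0 :=
  (ae_restrict_iff' hΩ.measurableSet).2 <|
    hΩ.ae_eq_zero_of_integral_contDiff_smul_eq_zero
      (locallyIntegrableOn_of_memLp_restrict hΩ hu hq) fun η hη hc hsub => by
        rw [← IsTest.setIntegral_smul ⟨hη, hc, hsub⟩]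
        exact h η ⟨hη, hc, hsub⟩

theorem ae_map_eq_zero_of_integral_isTest_smul [CompleteSpace F] [CompleteSpace H] (hΩ : IsOpen Ω)
    (hu : MemLp u 2 (m.restrict Ω)) (L : F →L[ℝ] H)
    (h : ∀ η : E → ℝ, IsTest Ω η → L (∫ x in Ω, η x • u x ∂m) = 0) :
    ∀ᵐ x ∂m.restrict Ω, L (u x) = 0 := by
  refine ae_eq_zero_of_integral_isTest_smul hΩ (L.comp_memLp' hu) one_le_two fun η hη => ?_
  rw [← h η hη, ← L.integral_comp_comm (integrable_smul_of_memLp (hη.memLp 2 _) hu)]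
  simp only [map_smul]

end FundamentalLemma

/-! ### The vertical rescaling -/

section VerticalScale

variable {ε : ℝ}

/-- The vertical dilation `(x̂, y₃) ↦ (x̂, ε y₃)`. -/
def verticalScale (hε : 0 < ε) : E3 ≃L[ℝ] E3 :=
  joinEquiv.symm.trans <|
    (((LinearEquiv.smulOfNeZero ℝ ℝ ε hε.ne').toContinuousLinearEquiv).prodCongr
      (ContinuousLinearEquiv.refl ℝ E2)).trans joinEquiv

theorem verticalScale_apply (hε : 0 < ε) (x : E3) :
    verticalScale hε x = join (hat x) (ε * x 2) := rfl

theorem verticalScale_single (hε : 0 < ε) (j : Fin 3) :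
    verticalScale hε (EuclideanSpace.single j 1) =
      (![1, 1, ε] : Fin 3 → ℝ) j • EuclideanSpace.single j 1 := by
  ext i
  fin_cases j <;> fin_cases i <;> simp [verticalScale_apply, join]

theorem measurableEmbedding_verticalScale (hε : 0 < ε) : MeasurableEmbedding (verticalScale hε) :=
  (verticalScale hε).toHomeomorph.measurableEmbedding

theorem det_verticalScale (hε : 0 < ε) :
    LinearMap.det ((verticalScale hε : E3 →L[ℝ] E3) : E3 →ₗ[ℝ] E3) = ε := by
  rw [← LinearMap.det_toMatrix (EuclideanSpace.basisFun (Fin 3) ℝ).toBasis, Matrix.det_fin_three]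
  simp [LinearMap.toMatrix_apply, verticalScale_single]

theorem map_verticalScale_volume (hε : 0 < ε) :
    Measure.map (verticalScale hε) volume = ENNReal.ofReal ε⁻¹ • (volume : Measure E3) := by
  have map_det := Measure.map_linearMap_addHaar_eq_smul_addHaar (volume : Measure E3)
    (f := ((verticalScale hε : E3 →L[ℝ] E3) : E3 →ₗ[ℝ] E3))
    (by rw [det_verticalScale]; exact hε.ne')
  rwa [det_verticalScale, abs_of_pos (inv_pos.2 hε)] at map_det

end VerticalScale

section Rescale

variable {G : E2 → ℝ} {ε : ℝ}

theorem preimage_thinDomain (hε : 0 < ε) :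
    verticalScale hε ⁻¹' thinDomain G ε = stretchedDomain G ε := by
  ext x
  simp only [thinDomain, stretchedDomain, Set.mem_preimage, verticalScale_apply,
    Set.mem_ofPred_eq, hat_join, join_apply_two, mul_pos_iff_of_pos_left hε,
    mul_lt_mul_iff_right₀ hε]

theorem measurableSet_thinDomain (hG : Measurable G) : MeasurableSet (thinDomain G ε) := by
  have hvert : Measurable fun x : E3 => x 2 :=
    (EuclideanSpace.proj (𝕜 := ℝ) (2 : Fin 3)).continuous.measurable
  have hcell : Measurable fun x : E3 => ε⁻¹ • hat x := hat.continuous.measurable.const_smul ε⁻¹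
  have hprofile : Measurable fun x : E3 => ε * G (ε⁻¹ • hat x) := (hG.comp hcell).const_mul ε
  exact (isOpen_omega.preimage hat.continuous).measurableSet.inter
    ((measurableSet_lt measurable_const hvert).inter (measurableSet_lt hvert hprofile))

theorem measurableSet_stretchedDomain (hG : Measurable G) (hε : 0 < ε) :
    MeasurableSet (stretchedDomain G ε) := by
  rw [← preimage_thinDomain hε]
  exact (measurableSet_thinDomain hG).preimage (verticalScale hε).continuous.measurable

theorem stretchedDomain_subset_fixedDomain {G₁ : ℝ} (hG : ∀ x, G x ≤ G₁) :
    stretchedDomain G ε ⊆ fixedDomain G₁ :=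
  fun _ hx => ⟨hx.1, hx.2.1, hx.2.2.trans_le (hG _)⟩

theorem map_restrict_stretchedDomain (hG : Measurable G) (hε : 0 < ε) :
    Measure.map (verticalScale hε) (volume.restrict (stretchedDomain G ε)) =
      ENNReal.ofReal ε⁻¹ • volume.restrict (thinDomain G ε) := by
  rw [← preimage_thinDomain hε, ← Measure.restrict_map (verticalScale hε).continuous.measurable
    (measurableSet_thinDomain hG), map_verticalScale_volume, Measure.restrict_smul]

/-- The extension by zero of a vertically rescaled function, so that
`rescaledVelocity G ε u = rescale G ε u`. -/
def rescale {F : Type*} [Zero F] (G : E2 → ℝ) (ε : ℝ) (u : E3 → F) : E3 → F :=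
  (stretchedDomain G ε).indicator fun x => u (join (hat x) (ε * x 2))

theorem rescale_eq {F : Type*} [Zero F] (hε : 0 < ε) (u : E3 → F) :
    rescale G ε u = (stretchedDomain G ε).indicator (u ∘ verticalScale hε) := rfl

theorem rescale_map {F H : Type*} [Zero F] [Zero H] {L : F → H} (hL : L 0 = 0) (u : E3 → F) :
    rescale G ε (fun x => L (u x)) = fun x => L (rescale G ε u x) :=
  Set.indicator_comp_of_zero hL

theorem rescale_eq_comp {F : Type*} [Zero F] (hε : 0 < ε) {u : E3 → F}
    (hu : Function.support u ⊆ thinDomain G ε) : rescale G ε u = u ∘ verticalScale hε := by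
  rw [rescale_eq hε, Set.indicator_eq_self, ← preimage_thinDomain hε]
  exact fun x hx => hu hx

theorem rescale_ae_eq_zero {F : Type*} [Zero F] (hG : Measurable G) (hε : 0 < ε) {u : E3 → F}
    (hu : ∀ᵐ x ∂volume.restrict (thinDomain G ε), u x = 0) :
    ∀ᵐ x : E3, rescale G ε u x = 0 := by
  have stretched : ∀ᵐ x ∂volume.restrict (stretchedDomain G ε), u (verticalScale hε x) = 0 := by
    have scaled : ∀ᵐ x ∂(volume.restrict (stretchedDomain G ε)).map (verticalScale hε),
        u x = 0 := by
      rw [map_restrict_stretchedDomain hG hε]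
      exact Measure.ae_smul_measure hu _
    exact ae_of_ae_map (verticalScale hε).continuous.aemeasurable scaled
  filter_upwards [(ae_restrict_iff' (measurableSet_stretchedDomain hG hε)).1 stretched] with x hx
  exact Set.indicator_apply_eq_zero.2 hx

variable {F : Type*} [NormedAddCommGroup F] {G₁ : ℝ}

theorem eLpNorm_rescale (hG : Measurable G) (hG₁ : ∀ x, G x ≤ G₁) (hε : 0 < ε) (u : E3 → F) :
    eLpNorm (rescale G ε u) 2 (volume.restrict (fixedDomain G₁)) =
      ENNReal.ofReal (ε ^ (-(1 / 2) : ℝ)) * eLpNorm u 2 (volume.restrict (thinDomain G ε)) := by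
  rw [rescale_eq hε, eLpNorm_indicator_eq_eLpNorm_restrict (measurableSet_stretchedDomain hG hε),
    Measure.restrict_restrict (measurableSet_stretchedDomain hG hε),
    Set.inter_eq_left.2 (stretchedDomain_subset_fixedDomain hG₁),
    ← (measurableEmbedding_verticalScale hε).eLpNorm_map_measure,
    map_restrict_stretchedDomain hG hε, eLpNorm_smul_measure_of_ne_top (by simp),
    ENNReal.ofReal_rpow_of_pos (inv_pos.2 hε), Real.inv_rpow hε.le, ← Real.rpow_neg hε.le,
    ENNReal.toReal_div, ENNReal.toReal_one, ENNReal.toReal_ofNat, smul_eq_mul]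

theorem toReal_eLpNorm_rescale (hG : Measurable G) (hG₁ : ∀ x, G x ≤ G₁) (hε : 0 < ε)
    (u : E3 → F) :
    (eLpNorm (rescale G ε u) 2 (volume.restrict (fixedDomain G₁))).toReal =
      ε ^ (-(1 / 2) : ℝ) * (eLpNorm u 2 (volume.restrict (thinDomain G ε))).toReal := by
  rw [eLpNorm_rescale hG hG₁ hε, ENNReal.toReal_mul,
    ENNReal.toReal_ofReal (Real.rpow_nonneg hε.le _)]

theorem memLp_rescale (hG : Measurable G) (hG₁ : ∀ x, G x ≤ G₁) (hε : 0 < ε) {u : E3 → F}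
    (hu : MemLp u 2 (volume.restrict (thinDomain G ε))) :
    MemLp (rescale G ε u) 2 (volume.restrict (fixedDomain G₁)) := by
  rw [rescale_eq hε, memLp_indicator_iff_restrict (measurableSet_stretchedDomain hG hε),
    Measure.restrict_restrict (measurableSet_stretchedDomain hG hε),
    Set.inter_eq_left.2 (stretchedDomain_subset_fixedDomain hG₁),
    ← (measurableEmbedding_verticalScale hε).memLp_map_measure_iff,
    map_restrict_stretchedDomain hG hε]
  exact hu.smul_measure ENNReal.ofReal_ne_top

theorem tendsto_eLpNorm_rescale_sub_rescale (hG : Measurable G) (hG₁ : ∀ x, G x ≤ G₁)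
    (hε : 0 < ε) {u : ℕ → E3 → F} {v : E3 → F}
    (h : Tendsto (fun k => eLpNorm (u k - v) 2 (volume.restrict (thinDomain G ε))) atTop (𝓝 0)) :
    Tendsto (fun k => eLpNorm (rescale G ε (u k) - rescale G ε v) 2
      (volume.restrict (fixedDomain G₁))) atTop (𝓝 0) := by
  have rescale_sub : ∀ k, rescale G ε (u k) - rescale G ε v = rescale G ε (u k - v) :=
    fun k => (Set.indicator_sub' _ _ _).symm
  simp_rw [rescale_sub, eLpNorm_rescale hG hG₁ hε]
  simpa only [mul_zero] using ENNReal.Tendsto.const_mul h (Or.inr ENNReal.ofReal_ne_top)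

variable [NormedSpace ℝ F]

theorem IsTest.rescale (hG₁ : ∀ x, G x ≤ G₁) (hε : 0 < ε) {φ : E3 → F}
    (hφ : IsTest (thinDomain G ε) φ) : IsTest (fixedDomain G₁) (rescale G ε φ) := by
  rw [rescale_eq_comp hε ((subset_tsupport φ).trans hφ.2.2)]
  exact hφ.comp_of_leftInverse (verticalScale hε).contDiff (verticalScale hε).symm.continuous
    (verticalScale hε).symm_apply_apply
    (preimage_thinDomain hε ▸ stretchedDomain_subset_fixedDomain hG₁)

/-- The change of gradients under the vertical dilation. -/
def scaleGrad (ε : ℝ) : Grad 3 F →L[ℝ] Grad 3 F :=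
  ((PiLp.continuousLinearEquiv 2 ℝ fun _ : Fin 3 => F).symm : (Fin 3 → F) →L[ℝ] Grad 3 F).comp <|
    ContinuousLinearMap.pi fun j =>
      (![1, 1, ε] : Fin 3 → ℝ) j • PiLp.proj 2 (fun _ : Fin 3 => F) j

theorem scaleGrad_apply (ε : ℝ) (D : Grad 3 F) (j : Fin 3) :
    scaleGrad ε D j = (![1, 1, ε] : Fin 3 → ℝ) j • D j := rfl

theorem classicalGrad_rescale (hε : 0 < ε) {φ : E3 → F} (hφ : IsTest (thinDomain G ε) φ) :
    classicalGrad (rescale G ε φ) = rescale G ε fun x => scaleGrad ε (classicalGrad φ x) := by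
  have support_grad :
      Function.support (fun x => scaleGrad ε (classicalGrad φ x)) ⊆ thinDomain G ε := by
    intro x hx
    by_contra hmem
    refine hx ?_
    have hfderiv : fderiv ℝ φ x = 0 :=
      image_eq_zero_of_notMem_tsupport fun h => hmem (hφ.2.2 (tsupport_fderiv_subset ℝ h))
    have : classicalGrad φ x = 0 := PiLp.ext fun j => by
      rw [classicalGrad_apply, hfderiv, PiLp.zero_apply, zero_apply]
    simp only [this, map_zero]
  rw [rescale_eq_comp hε ((subset_tsupport φ).trans hφ.2.2), rescale_eq_comp hε support_grad]
  refine funext fun x => PiLp.ext fun j => ?_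
  have chain := ((hφ.1.differentiable (by simp) _).hasFDerivAt.comp x
    (verticalScale hε).hasFDerivAt).fderiv
  rw [classicalGrad_apply, chain, Function.comp_apply, scaleGrad_apply, classicalGrad_apply,
    ← map_smul, ← verticalScale_single hε]
  rfl

theorem hasH10Grad_rescale [CompleteSpace F] (hG : Measurable G) (hG₁ : ∀ x, G x ≤ G₁)
    (hε : 0 < ε) {u : E3 → F} {Du : E3 → Grad 3 F} (hu : HasH10Grad (thinDomain G ε) u Du) :
    HasH10Grad (fixedDomain G₁) (rescale G ε u) (rescale G ε fun x => scaleGrad ε (Du x)) := by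
  obtain ⟨⟨hu, hDu, -⟩, φ, hφ, h, hD⟩ := hu
  have hDu' : MemLp (rescale G ε fun x => scaleGrad ε (Du x)) 2
      (volume.restrict (fixedDomain G₁)) :=
    memLp_rescale hG hG₁ hε ((scaleGrad (F := F) ε).comp_memLp' hDu)
  have hD' := tendsto_eLpNorm_rescale_sub_rescale hG hG₁ hε
    (tendsto_eLpNorm_comp_sub_comp (scaleGrad (F := F) ε) hD)
  refine hasH10Grad_of_tendsto (memLp_rescale hG hG₁ hε hu) hDu'
    (fun k => (hφ k).rescale hG₁ hε) (tendsto_eLpNorm_rescale_sub_rescale hG hG₁ hε h) ?_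
  exact hD'.congr fun k => by rw [classicalGrad_rescale hε (hφ k)]

end Rescale

/-! ### A priori bounds for the rescaled Bingham velocity -/

section Energy

variable {μ g ε G₁ : ℝ} {G : E2 → ℝ}

theorem isAdmissible_zero (Ω : Set E3) : IsAdmissible Ω 0 0 := by
  have isTest_zero : IsTest Ω (0 : E3 → E3) :=
    ⟨contDiff_const, HasCompactSupport.zero, by simp [tsupport]⟩
  have grad_zero : classicalGrad (0 : E3 → E3) = 0 := by
    ext x j : 2
    simp [classicalGrad_apply]
  refine ⟨hasH10Grad_of_tendsto MemLp.zero MemLp.zero (φ := fun _ => 0) (fun _ => isTest_zero)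
    ?_ ?_, ?_⟩ <;> simp [grad_zero]

/-- Testing the variational inequality with `v = 0`, the yield stress only helps. -/
theorem IsBinghamVelocity.energy_le (hg : 0 ≤ g) (hε : 0 < ε) {f u : E3 → E3}
    (hf : MemLp f 2 (volume.restrict (thinDomain G ε))) (hu : IsBinghamVelocity μ g G ε f u) :
    ∃ Du, IsAdmissible (thinDomain G ε) u Du ∧
      μ * ε ^ 2 * (eLpNorm Du 2 (volume.restrict (thinDomain G ε))).toReal ^ 2 ≤
        (eLpNorm f 2 (volume.restrict (thinDomain G ε))).toReal *
          (eLpNorm u 2 (volume.restrict (thinDomain G ε))).toReal := by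
  obtain ⟨Du, hDu, inequality⟩ := hu
  have test_zero := inequality 0 0 (isAdmissible_zero _)
  simp only [Pi.zero_apply, zero_sub, inner_neg_right, integral_neg, norm_zero, integral_zero,
    integral_inner_self_eq_eLpNorm_sq hDu.1.1.2.1, mul_zero, add_zero] at test_zero
  have work_le := integral_inner_le_eLpNorm_mul_eLpNorm hf hDu.1.1.1
  have plastic_nonneg : 0 ≤ g * ε * ∫ x in thinDomain G ε, ‖Du x‖ :=
    mul_nonneg (mul_nonneg hg hε.le) (integral_nonneg fun x => norm_nonneg _)
  exact ⟨Du, hDu, by linarith⟩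

theorem rescale_scaleGrad_two {F : Type*} [NormedAddCommGroup F] [NormedSpace ℝ F]
    (Du : E3 → Grad 3 F) :
    (fun x => rescale G ε (fun x => scaleGrad ε (Du x)) x 2) =
      rescale G ε fun x => ε • Du x 2 :=
  (rescale_map (L := fun D : Grad 3 F => D 2) rfl _).symm

theorem toReal_eLpNorm_rescale_scaleGrad_two_le {F : Type*} [NormedAddCommGroup F]
    [NormedSpace ℝ F] (hG : Measurable G) (hG₁ : ∀ x, G x ≤ G₁) (hε : 0 < ε)
    {Du : E3 → Grad 3 F} (hDu : MemLp Du 2 (volume.restrict (thinDomain G ε))) :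
    (eLpNorm (fun x => rescale G ε (fun x => scaleGrad ε (Du x)) x 2) 2
      (volume.restrict (fixedDomain G₁))).toReal ≤
      ε ^ (-(1 / 2) : ℝ) * (ε * (eLpNorm Du 2 (volume.restrict (thinDomain G ε))).toReal) := by
  have component_le : eLpNorm (fun x => Du x 2) 2 (volume.restrict (thinDomain G ε)) ≤
      eLpNorm Du 2 (volume.restrict (thinDomain G ε)) :=
    eLpNorm_mono fun x => PiLp.norm_apply_le (Du x) 2
  have smul_norm : eLpNorm (fun x => ε • Du x 2) 2 (volume.restrict (thinDomain G ε)) =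
      ‖ε‖ₑ * eLpNorm (fun x => Du x 2) 2 (volume.restrict (thinDomain G ε)) :=
    eLpNorm_const_smul ε (fun x => Du x 2) 2 _
  rw [rescale_scaleGrad_two, toReal_eLpNorm_rescale hG hG₁ hε, smul_norm, ENNReal.toReal_mul,
    toReal_enorm, Real.norm_of_nonneg hε.le]
  gcongr
  exact hDu.2.ne

/-- The rescaled divergence `ε div_x̂ Û + ∂₃ U₃`, as a function of the gradient of `U`. -/
def rescaledDiv (ε : ℝ) : Grad 3 E3 →L[ℝ] ℝ :=
  let entry (j : Fin 3) : Grad 3 E3 →L[ℝ] ℝ :=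
    (EuclideanSpace.proj j).comp (PiLp.proj 2 (fun _ : Fin 3 => E3) j)
  ε • (entry 0 + entry 1) + entry 2

theorem rescaledDiv_apply (ε : ℝ) (D : Grad 3 E3) :
    rescaledDiv ε D = ε * (D 0 0 + D 1 1) + D 2 2 := rfl

theorem rescaledDiv_scaleGrad (ε : ℝ) (D : Grad 3 E3) :
    rescaledDiv ε (scaleGrad ε D) = ε * ∑ j, D j j := by
  simp only [rescaledDiv_apply, scaleGrad_apply, PiLp.smul_apply, smul_eq_mul, Matrix.cons_val,
    Fin.sum_univ_three]
  ring

theorem rescaledDiv_rescale_ae_eq_zero (hG : Measurable G) (hε : 0 < ε) {Du : E3 → Grad 3 E3}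
    (hDu : ∀ᵐ x ∂volume.restrict (thinDomain G ε), ∑ j, Du x j j = 0) :
    ∀ᵐ x : E3, rescaledDiv ε (rescale G ε (fun x => scaleGrad ε (Du x)) x) = 0 := by
  have thin : ∀ᵐ x ∂volume.restrict (thinDomain G ε), rescaledDiv ε (scaleGrad ε (Du x)) = 0 := by
    filter_upwards [hDu] with x hx
    rw [rescaledDiv_scaleGrad, hx, mul_zero]
  simpa only [rescale_map (map_zero (rescaledDiv ε))] using rescale_ae_eq_zero hG hε thin

theorem HasH10Grad.eLpNorm_le_eLpNorm_vertical {F : Type*} [NormedAddCommGroup F]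
    [InnerProductSpace ℝ F] [CompleteSpace F] {U : E3 → F} {DU : E3 → Grad 3 F}
    (hU : HasH10Grad (fixedDomain G₁) U DU) :
    (eLpNorm U 2 (volume.restrict (fixedDomain G₁))).toReal ≤
      2 * |G₁| * (eLpNorm (fun x => DU x 2) 2 (volume.restrict (fixedDomain G₁))).toReal :=
  hU.eLpNorm_le_eLpNorm_grad (isOpen_fixedDomain G₁).measurableSet 2 (abs_nonneg _) fun _ hx =>
    (abs_of_pos hx.2.1).trans_le (hx.2.2.le.trans (le_abs_self _))

theorem eLpNorm_vertical_le_of_energy_le (hμ : 0 < μ) (hG : Measurable G) (hG₁ : ∀ x, G x ≤ G₁)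
    (hε : 0 < ε) {f u : E3 → E3} {Du : E3 → Grad 3 E3}
    (hu : HasH10Grad (thinDomain G ε) u Du)
    (energy : μ * ε ^ 2 * (eLpNorm Du 2 (volume.restrict (thinDomain G ε))).toReal ^ 2 ≤
      (eLpNorm f 2 (volume.restrict (thinDomain G ε))).toReal *
        (eLpNorm u 2 (volume.restrict (thinDomain G ε))).toReal) :
    (eLpNorm (fun x => rescale G ε (fun x => scaleGrad ε (Du x)) x 2) 2
      (volume.restrict (fixedDomain G₁))).toReal ≤ 2 * |G₁| * rescaledL2Norm G ε f / μ := by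
  set s : ℝ := ε ^ (-(1 / 2) : ℝ) with hs
  set d := (eLpNorm (fun x => rescale G ε (fun x => scaleGrad ε (Du x)) x 2) 2
    (volume.restrict (fixedDomain G₁))).toReal
  have hd : 0 ≤ d := ENNReal.toReal_nonneg
  have hf : 0 ≤ rescaledL2Norm G ε f :=
    mul_nonneg (Real.rpow_nonneg hε.le _) ENNReal.toReal_nonneg
  have poincare : s * (eLpNorm u 2 (volume.restrict (thinDomain G ε))).toReal ≤ 2 * |G₁| * d := by
    rw [hs, ← toReal_eLpNorm_rescale hG hG₁ hε]
    exact (hasH10Grad_rescale hG hG₁ hε hu).eLpNorm_le_eLpNorm_vertical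
  have quadratic : μ * d ^ 2 ≤ 2 * |G₁| * rescaledL2Norm G ε f * d :=
    calc μ * d ^ 2
        ≤ μ * (s * (ε * (eLpNorm Du 2 (volume.restrict (thinDomain G ε))).toReal)) ^ 2 := by
          gcongr
          exact toReal_eLpNorm_rescale_scaleGrad_two_le hG hG₁ hε hu.1.2.1
      _ = s ^ 2 * (μ * ε ^ 2 * (eLpNorm Du 2 (volume.restrict (thinDomain G ε))).toReal ^ 2) := by
          ring
      _ ≤ s ^ 2 * ((eLpNorm f 2 (volume.restrict (thinDomain G ε))).toReal *
            (eLpNorm u 2 (volume.restrict (thinDomain G ε))).toReal) := by gcongr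
      _ = rescaledL2Norm G ε f *
            (s * (eLpNorm u 2 (volume.restrict (thinDomain G ε))).toReal) := by
          rw [rescaledL2Norm]; ring
      _ ≤ rescaledL2Norm G ε f * (2 * |G₁| * d) := by gcongr
      _ = 2 * |G₁| * rescaledL2Norm G ε f * d := by ring
  rw [le_div_iff₀' hμ]
  rcases hd.eq_or_lt with h0 | hpos
  · rw [← h0, mul_zero]
    positivity
  · exact le_of_mul_le_mul_right (by linarith) hpos

theorem IsBinghamVelocity.exists_rescaled_grad (hμ : 0 < μ) (hg : 0 ≤ g) (hε : 0 < ε)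
    (hG : Measurable G) (hG₁ : ∀ x, G x ≤ G₁) {f u : E3 → E3}
    (hf : MemLp f 2 (volume.restrict (thinDomain G ε))) (hu : IsBinghamVelocity μ g G ε f u) :
    ∃ DU, HasH10Grad (fixedDomain G₁) (rescaledVelocity G ε u) DU ∧
      (∀ᵐ x ∂volume.restrict (fixedDomain G₁), rescaledDiv ε (DU x) = 0) ∧
      (eLpNorm (fun x => DU x 2) 2 (volume.restrict (fixedDomain G₁))).toReal ≤
        2 * |G₁| * rescaledL2Norm G ε f / μ := by
  obtain ⟨Du, ⟨hDu, hdiv⟩, energy⟩ := hu.energy_le hg hε hf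
  exact ⟨_, hasH10Grad_rescale hG hG₁ hε hDu,
    ae_restrict_of_ae (rescaledDiv_rescale_ae_eq_zero hG hε hdiv),
    eLpNorm_vertical_le_of_energy_le hμ hG hG₁ hε hDu energy⟩

end Energy

/-! ### Moments of the profiles and passage to the limit -/

theorem HasH10Grad.map_integral_grad_smul_eq_zero {d : ℕ} {F H : Type*} [NormedAddCommGroup F]
    [NormedSpace ℝ F] [CompleteSpace F] [NormedAddCommGroup H] [NormedSpace ℝ H] [CompleteSpace H]
    {Ω : Set (EuclideanSpace ℝ (Fin d))} {u : EuclideanSpace ℝ (Fin d) → F}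
    {Du : EuclideanSpace ℝ (Fin d) → Grad d F} (hu : HasH10Grad Ω u Du) (L : Grad d F →L[ℝ] H)
    (hL : ∀ᵐ x ∂volume.restrict Ω, L (Du x) = 0) {ψ : EuclideanSpace ℝ (Fin d) → ℝ}
    {Dψ : EuclideanSpace ℝ (Fin d) → Grad d ℝ} (hψ : HasH1Grad Ω ψ Dψ) :
    L (WithLp.toLp 2 fun j => ∫ x in Ω, Dψ x j • u x) = 0 := by
  have integrable := integrable_smul_of_memLp hψ.1 hu.1.2.1
  have parts : (WithLp.toLp 2 fun j => ∫ x in Ω, Dψ x j • u x) = -∫ x in Ω, ψ x • Du x := by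
    refine PiLp.ext fun j => (hu.integral_smul hψ j).trans (congrArg Neg.neg ?_)
    exact (PiLp.proj (𝕜 := ℝ) 2 (fun _ : Fin d => F) j).integral_comp_comm integrable
  rw [parts, map_neg, ← L.integral_comp_comm integrable, integral_eq_zero_of_ae, neg_zero]
  filter_upwards [hL] with x hx
  rw [map_smul, hx, smul_zero, Pi.zero_apply]

theorem exists_contDiff_deriv_eq {φ : ℝ → ℝ} (hφ : ContDiff ℝ ∞ φ) :
    ∃ Φ : ℝ → ℝ, ContDiff ℝ ∞ Φ ∧ deriv Φ = φ := by
  have primitive : ∀ t, HasDerivAt (fun t => ∫ s in (0 : ℝ)..t, φ s) (φ t) t := fun t =>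
    (hφ.continuous.integral_hasStrictDerivAt 0 t).hasDerivAt
  have deriv_primitive : deriv (fun t => ∫ s in (0 : ℝ)..t, φ s) = φ :=
    funext fun t => (primitive t).deriv
  exact ⟨_, contDiff_infty_iff_deriv.2
    ⟨fun t => (primitive t).differentiableAt, by simpa only [deriv_primitive] using hφ⟩,
    deriv_primitive⟩

section Moment

variable {h : ℝ} {a : ℝ → ℝ} {b : E2 → ℝ} {u : E3 → E3} {Du : E3 → Grad 3 E3}

theorem smulIntegral_smulIntegral_fixedDomain
    {A : Lp L2omega3 2 (volume.restrict (Set.Ioo 0 h))} {w : E3 → E3}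
    (hw : MemLp w 2 (volume.restrict (fixedDomain h)))
    (hA : ∀ᵐ t ∂volume.restrict (Set.Ioo 0 h), ∀ᵐ x ∂volume.restrict omega, A t x = w (join x t))
    (ha : MemLp a 2 (volume.restrict (Set.Ioo 0 h))) (hb : MemLp b 2 (volume.restrict omega)) :
    smulIntegral hb (smulIntegral ha A) = ∫ x in fixedDomain h, (a (x 2) * b (hat x)) • w x := by
  rw [integral_fixedDomain]
  simpa using smulIntegral_smulIntegral (w := fun z : ℝ × E2 => w (join z.2 z.1)) (by simp)
    (memLp_fixedDomain_iff.1 hw) hA ha hb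

theorem HasH10Grad.mem_H1 (hu : HasH10Grad (fixedDomain h) u Du)
    {A B : Lp L2omega3 2 (volume.restrict (Set.Ioo 0 h))}
    (hA : ∀ᵐ t ∂volume.restrict (Set.Ioo 0 h), ∀ᵐ x ∂volume.restrict omega, A t x = u (join x t))
    (hB : ∀ᵐ t ∂volume.restrict (Set.Ioo 0 h), ∀ᵐ x ∂volume.restrict omega,
      B t x = Du (join x t) 2) :
    WithLp.toLp 2 (A, B) ∈ H1 0 h L2omega3 := by
  refine mem_H1_iff.2 fun φ hφ => eq_neg_iff_add_eq_zero.2 ?_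
  refine (Lp.eq_zero_iff_ae_eq_zero).2 ?_
  refine ae_eq_zero_of_integral_isTest_smul isOpen_omega (Lp.memLp _) one_le_two fun η hη => ?_
  have parts := hu.integral_smul (HasH1Grad.tensor hφ.1 (hasH1Grad_classicalGrad isBounded_omega
    hη.1)) 2
  have left := smulIntegral_smulIntegral_fixedDomain hu.1.1 hA (hφ.deriv.memLp 2 _) (hη.memLp 2 _)
  have right := smulIntegral_smulIntegral_fixedDomain (w := fun x => Du x 2) (hu.1.2.1.eval_piLp 2)
    hB (hφ.memLp 2 _) (hη.memLp 2 _)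
  refine (smulIntegral_apply (hη.memLp 2 _) _).symm.trans ((map_add _ _ _).trans ?_)
  exact (congrArg₂ (· + ·) (left.trans parts) right).trans (neg_add_cancel _)

theorem exists_curry_fixedDomain {w : E3 → E3} (hw : MemLp w 2 (volume.restrict (fixedDomain h))) :
    ∃ A : Lp L2omega3 2 (volume.restrict (Set.Ioo 0 h)),
      (∀ᵐ t ∂volume.restrict (Set.Ioo 0 h), ∀ᵐ x ∂volume.restrict omega, A t x = w (join x t)) ∧
      ‖A‖ = (eLpNorm w 2 (volume.restrict (fixedDomain h))).toReal := by
  have hw' := memLp_fixedDomain_iff.1 hw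
  obtain ⟨A, hA⟩ := exists_curry (by simp) hw'
  refine ⟨A, hA, ?_⟩
  rw [Lp.norm_def, eLpNorm_curry (by simp) (by simp) hw'.1 hA,
    ← (measurePreserving_joinEquiv_fixedDomain h).map_eq,
    measurableEmbedding_joinEquiv.eLpNorm_map_measure]
  rfl

theorem HasH10Grad.exists_represents (hu : HasH10Grad (fixedDomain h) u Du) :
    ∃ W : H1 0 h L2omega3, Represents W u ∧ ‖W‖ ≤
      (2 * |h| + 1) * (eLpNorm (fun x => Du x 2) 2 (volume.restrict (fixedDomain h))).toReal := by
  have curry_u := exists_curry_fixedDomain hu.1.1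
  have curry_Du := exists_curry_fixedDomain (w := fun x => Du x 2) (hu.1.2.1.eval_piLp 2)
  obtain ⟨A, hA, normA⟩ := curry_u
  obtain ⟨B, hB, normB⟩ := curry_Du
  refine ⟨⟨WithLp.toLp 2 (A, B), hu.mem_H1 hA hB⟩, hA, ?_⟩
  refine (norm_le_add_norm (WithLp.toLp 2 (A, B))).trans ?_
  refine (add_le_add (normA.le.trans hu.eLpNorm_le_eLpNorm_vertical) normB.le).trans_eq ?_
  rw [add_mul, one_mul]

end Moment

theorem compLp_eq_zero_iff {α F H : Type*} [MeasurableSpace α] {m : Measure α} {p : ENNReal}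
    [NormedAddCommGroup F] [NormedSpace ℝ F] [NormedAddCommGroup H] [NormedSpace ℝ H]
    (L : F →L[ℝ] H) (u : Lp F p m) : L.compLp u = 0 ↔ ∀ᵐ x ∂m, L (u x) = 0 := by
  rw [Lp.eq_zero_iff_ae_eq_zero]
  exact ⟨fun hu => (L.coeFn_compLp' u).symm.trans hu, fun hu => (L.coeFn_compLp' u).trans hu⟩

theorem integral_inner_eq_sum_integral_smul {α ι : Type*} [Fintype ι] [MeasurableSpace α]
    {m : Measure α} {V b : α → EuclideanSpace ℝ ι} (hV : MemLp V 2 m) (hb : MemLp b 2 m) :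
    ∫ x, ⟪V x, b x⟫_ℝ ∂m = ∑ i, (∫ x, b x i • V x ∂m) i := by
  have component (i : ι) : (∫ x, b x i • V x ∂m) i = ∫ x, b x i * V x i ∂m :=
    ((EuclideanSpace.proj (𝕜 := ℝ) i).integral_comp_comm
      (integrable_smul_of_memLp (hb.eval_piLp i) hV)).symm
  simp only [component, PiLp.inner_apply, RCLike.inner_apply, conj_trivial]
  exact integral_finsetSum _ fun i _ => integrable_smul_of_memLp (hb.eval_piLp i) (hV.eval_piLp i)

section Moment

variable {h ε : ℝ} {a : ℝ → ℝ} {b : E2 → ℝ} {W U : H1 0 h L2omega3}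

/-- The moment `∫ a(y₃) b(x̂) U(x̂, y₃)` of a profile `U` against a product of functions of separate
variables. -/
def moment (a : ℝ → ℝ) (b : E2 → ℝ) (U : H1 0 h L2omega3) : E3 :=
  ∫ x in omega, b x • (∫ t in Set.Ioo 0 h, a t • h1ToLp U t : L2omega3) x

theorem moment_eq_smulIntegral (ha : MemLp a 2 (volume.restrict (Set.Ioo 0 h)))
    (hb : MemLp b 2 (volume.restrict omega)) (U : H1 0 h L2omega3) :
    moment a b U = smulIntegral hb (smulIntegral ha (h1ToLp U)) := by
  rw [smulIntegral_apply ha, smulIntegral_apply hb]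
  rfl

theorem moment_eq_integral_of_represents {w : E3 → E3} (hW : Represents W w)
    (hw : MemLp w 2 (volume.restrict (fixedDomain h)))
    (ha : MemLp a 2 (volume.restrict (Set.Ioo 0 h))) (hb : MemLp b 2 (volume.restrict omega)) :
    moment a b W = ∫ x in fixedDomain h, (a (x 2) * b (hat x)) • w x :=
  (moment_eq_smulIntegral ha hb W).trans (smulIntegral_smulIntegral_fixedDomain hw hW ha hb)

theorem WeakTendsto.moment_apply {W : ℕ → H1 0 h L2omega3} (hW : WeakTendsto W U)
    (ha : MemLp a 2 (volume.restrict (Set.Ioo 0 h))) (hb : MemLp b 2 (volume.restrict omega))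
    (i : Fin 3) : Tendsto (fun k => moment a b (W k) i) atTop (𝓝 (moment a b U i)) := by
  simp only [moment_eq_smulIntegral ha hb]
  exact weakTendsto_iff.1 hW ((EuclideanSpace.proj (𝕜 := ℝ) i).comp
    ((smulIntegral hb).comp ((smulIntegral ha).comp h1ToLp)))

/-- The weak form of `ε div_x̂ Û + ∂₃ U₃ = 0` in `ω × (0, h)` together with the vanishing of the
normal flux through the boundary, tested against the products `a(y₃) b(x̂)` with `a` smooth and
`b ∈ H¹(ω)`. For `ε = 0` this is the limit equation `∂₃ U₃ = 0`. -/
def IsRescaledSolenoidal (ε : ℝ) (U : H1 0 h L2omega3) : Prop :=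
  ∀ (a : ℝ → ℝ) (b : E2 → ℝ) (Db : E2 → Grad 2 ℝ), ContDiff ℝ ∞ a → HasH1Grad omega b Db →
    ε * (moment a (fun x => Db x 0) U 0 + moment a (fun x => Db x 1) U 1) +
      moment (deriv a) b U 2 = 0

theorem HasH10Grad.isRescaledSolenoidal {u : E3 → E3} {Du : E3 → Grad 3 E3}
    (hu : HasH10Grad (fixedDomain h) u Du)
    (hdiv : ∀ᵐ x ∂volume.restrict (fixedDomain h), rescaledDiv ε (Du x) = 0)
    (hW : Represents W u) : IsRescaledSolenoidal ε W := by
  intro a b Db ha hb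
  have weak := hu.map_integral_grad_smul_eq_zero (rescaledDiv ε) hdiv (HasH1Grad.tensor ha hb)
  have horizontal (j : Fin 2) := moment_eq_integral_of_represents hW hu.1.1
    (memLp_Ioo ha.continuous 0 h 2) (hb.2.1.eval_piLp j)
  have vertical := moment_eq_integral_of_represents hW hu.1.1
    (memLp_Ioo (ha.continuous_deriv (by simp)) 0 h 2) hb.1
  rw [horizontal 0, horizontal 1, vertical]
  exact weak

theorem IsRescaledSolenoidal.of_weakTendsto {η : ℕ → ℝ} {W : ℕ → H1 0 h L2omega3}
    (hη : Tendsto η atTop (𝓝 ε)) (hW : WeakTendsto W U)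
    (hdiv : ∀ k, IsRescaledSolenoidal (η k) (W k)) : IsRescaledSolenoidal ε U := by
  intro a b Db ha hb
  have horizontal (j : Fin 2) := hW.moment_apply (memLp_Ioo ha.continuous 0 h 2)
    (hb.2.1.eval_piLp j)
  have vertical := hW.moment_apply (memLp_Ioo (ha.continuous_deriv (by simp)) 0 h 2) hb.1
  refine tendsto_nhds_unique
    ((hη.mul ((horizontal 0 0).add (horizontal 1 1))).add (vertical 2)) ?_
  simp only [hdiv _ a b Db ha hb, tendsto_const_nhds]

theorem IsRescaledSolenoidal.moment_two_eq_zero (hU : IsRescaledSolenoidal 0 U)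
    (ha : ContDiff ℝ ∞ a) {Db : E2 → Grad 2 ℝ} (hb : HasH1Grad omega b Db) :
    moment a b U 2 = 0 := by
  obtain ⟨A, hA, rfl⟩ := exists_contDiff_deriv_eq ha
  simpa only [zero_mul, zero_add] using hU A b Db hA hb

theorem IsRescaledSolenoidal.vertical_eq_zero (hU : IsRescaledSolenoidal 0 U) :
    ∀ᵐ t ∂volume.restrict (Set.Ioo 0 h), ∀ᵐ x ∂volume.restrict omega, h1Fun U t x 2 = 0 := by
  let vertical : E3 →L[ℝ] ℝ := EuclideanSpace.proj (𝕜 := ℝ) (2 : Fin 3)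
  have weak (φ : ℝ → ℝ) (hφ : IsTest (Set.Ioo 0 h) φ) :
      vertical.compLp (∫ t in Set.Ioo 0 h, φ t • h1ToLp U t) = 0 := by
    refine (compLp_eq_zero_iff _ _).2 <| ae_map_eq_zero_of_integral_isTest_smul isOpen_omega
      (Lp.memLp _) vertical fun η hη => ?_
    exact hU.moment_two_eq_zero hφ.1 (hasH1Grad_classicalGrad isBounded_omega hη.1)
  filter_upwards [ae_map_eq_zero_of_integral_isTest_smul isOpen_Ioo (Lp.memLp (h1ToLp U))
    (vertical.compLpL 2 (volume.restrict omega)) weak] with t ht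
  exact (compLp_eq_zero_iff vertical _).1 ht

theorem verticalIntegral_eq_compLp (U : H1 0 h L2omega3) :
    verticalIntegral U = hat.compLp (∫ t in Set.Ioo 0 h, h1ToLp U t) :=
  (hat.compLpL 2 (volume.restrict omega)).integral_comp_comm
    ((Lp.memLp (h1ToLp U)).integrable one_le_two)

theorem integral_smul_verticalIntegral (U : H1 0 h L2omega3)
    (hb : MemLp b 2 (volume.restrict omega)) :
    ∫ x in omega, b x • verticalIntegral U x = hat (moment (fun _ => 1) b U) := by
  have weighted : (∫ t in Set.Ioo 0 h, (1 : ℝ) • h1ToLp U t : L2omega3) =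
      ∫ t in Set.Ioo 0 h, h1ToLp U t := by simp only [one_smul]
  have total := verticalIntegral_eq_compLp U
  rw [← weighted] at total
  rw [total]
  exact integral_smul_compLp hat hb _

theorem integral_inner_verticalIntegral_eq_moment (U : H1 0 h L2omega3) {b : E2 → Grad 2 ℝ}
    (hb : MemLp b 2 (volume.restrict omega)) :
    ∫ x in omega, ⟪verticalIntegral U x, b x⟫_ℝ =
      moment (fun _ => 1) (fun x => b x 0) U 0 + moment (fun _ => 1) (fun x => b x 1) U 1 := by
  rw [integral_inner_eq_sum_integral_smul (Lp.memLp _) hb, Fin.sum_univ_two,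
    integral_smul_verticalIntegral U (hb.eval_piLp 0),
    integral_smul_verticalIntegral U (hb.eval_piLp 1), hat_apply_zero, hat_apply_one]

theorem moment_zero_left (hb : MemLp b 2 (volume.restrict omega)) (U : H1 0 h L2omega3) :
    moment (fun _ => 0) b U = 0 := by
  have ha : MemLp (fun _ : ℝ => (0 : ℝ)) 2 (volume.restrict (Set.Ioo 0 h)) := MemLp.zero
  rw [moment_eq_smulIntegral ha hb, smulIntegral_apply ha]
  simp only [zero_smul, integral_zero, map_zero]

theorem IsRescaledSolenoidal.integral_inner_verticalIntegral (hε : ε ≠ 0)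
    (hU : IsRescaledSolenoidal ε U) {ψ : E2 → ℝ} {Dψ : E2 → Grad 2 ℝ} (hψ : HasH1Grad omega ψ Dψ) :
    ∫ x in omega, ⟪verticalIntegral U x, Dψ x⟫_ℝ = 0 := by
  have key := hU (fun _ => 1) ψ Dψ contDiff_const hψ
  rw [deriv_const', moment_zero_left hψ.1, PiLp.zero_apply, add_zero] at key
  rw [integral_inner_verticalIntegral_eq_moment U hψ.2.1]
  exact (mul_eq_zero.1 key).resolve_left hε

theorem WeakTendsto.integral_inner_verticalIntegral {W : ℕ → H1 0 h L2omega3}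
    (hW : WeakTendsto W U) {b : E2 → Grad 2 ℝ} (hb : MemLp b 2 (volume.restrict omega)) :
    Tendsto (fun k => ∫ x in omega, ⟪verticalIntegral (W k) x, b x⟫_ℝ) atTop
      (𝓝 (∫ x in omega, ⟪verticalIntegral U x, b x⟫_ℝ)) := by
  simp only [integral_inner_verticalIntegral_eq_moment _ hb]
  exact (hW.moment_apply (memLp_const 1) (hb.eval_piLp 0) 0).add
    (hW.moment_apply (memLp_const 1) (hb.eval_piLp 1) 1)

end Moment

section Orthogonality

variable {d : ℕ} {Ω : Set (EuclideanSpace ℝ (Fin d))}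
  {V : EuclideanSpace ℝ (Fin d) → EuclideanSpace ℝ (Fin d)}

theorem hasWeakDiv_zero_of_forall_integral_inner_eq_zero (hΩ : Bornology.IsBounded Ω)
    (hV : MemLp V 2 (volume.restrict Ω))
    (orth : ∀ ψ Dψ, HasH1Grad Ω ψ Dψ → ∫ x in Ω, ⟪V x, Dψ x⟫_ℝ = 0) : HasWeakDiv Ω V 0 := by
  refine ⟨hV, MemLp.zero, fun φ hφ => ?_⟩
  rw [orth φ _ (hasH1Grad_classicalGrad hΩ hφ.1)]
  simp

theorem zeroNormalTrace_of_forall_integral_inner_eq_zero (hdiv : HasWeakDiv Ω V 0)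
    (orth : ∀ ψ Dψ, HasH1Grad Ω ψ Dψ → ∫ x in Ω, ⟪V x, Dψ x⟫_ℝ = 0) : ZeroNormalTrace Ω V := by
  refine ⟨0, hdiv, fun ψ Dψ hψ => ?_⟩
  rw [orth ψ Dψ hψ]
  simp

end Orthogonality

/-! ### The limit profile -/

section Limit

variable {h : ℝ} {ε : ℕ → ℝ} {W : ℕ → H1 0 h L2omega3} {U : H1 0 h L2omega3}

theorem vertical_eq_zero_of_weakTendsto (hε0 : Tendsto ε atTop (𝓝 0)) (hW : WeakTendsto W U)
    (hdiv : ∀ k, IsRescaledSolenoidal (ε k) (W k)) :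
    ∀ᵐ t ∂volume.restrict (Set.Ioo 0 h), ∀ᵐ x ∂volume.restrict omega, h1Fun U t x 2 = 0 :=
  (IsRescaledSolenoidal.of_weakTendsto hε0 hW hdiv).vertical_eq_zero

theorem integral_inner_verticalIntegral_eq_zero_of_weakTendsto (hε : ∀ k, ε k ≠ 0)
    (hW : WeakTendsto W U) (hdiv : ∀ k, IsRescaledSolenoidal (ε k) (W k)) {ψ : E2 → ℝ}
    {Dψ : E2 → Grad 2 ℝ} (hψ : HasH1Grad omega ψ Dψ) :
    ∫ x in omega, ⟪verticalIntegral U x, Dψ x⟫_ℝ = 0 := by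
  have limit := hW.integral_inner_verticalIntegral hψ.2.1
  simp only [(hdiv _).integral_inner_verticalIntegral (hε _) hψ] at limit
  exact tendsto_nhds_unique limit tendsto_const_nhds

end Limit

theorem IsBinghamVelocity.exists_represents {μ g ε G₁ : ℝ} {G : E2 → ℝ} (hμ : 0 < μ) (hg : 0 ≤ g)
    (hε : 0 < ε) (hG : Measurable G) (hG₁ : ∀ x, G x ≤ G₁) {f u : E3 → E3}
    (hf : MemLp f 2 (volume.restrict (thinDomain G ε))) (hu : IsBinghamVelocity μ g G ε f u) :
    MemH10 (fixedDomain G₁) (rescaledVelocity G ε u) ∧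
      ∃ W : H1 0 G₁ L2omega3, Represents W (rescaledVelocity G ε u) ∧ IsRescaledSolenoidal ε W ∧
        ‖W‖ ≤ (2 * |G₁| + 1) * (2 * |G₁| * rescaledL2Norm G ε f / μ) := by
  have rescaled := hu.exists_rescaled_grad hμ hg hε hG hG₁ hf
  obtain ⟨DU, hDU, hdiv, bound⟩ := rescaled
  have profile := hDU.exists_represents
  obtain ⟨W, hW, normW⟩ := profile
  exact ⟨⟨DU, hDU⟩, W, hW, hDU.isRescaledSolenoidal hdiv hW, normW.trans (by gcongr)⟩

end

end BinghamThin

open BinghamThin in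
theorem proposition5p1_general (G₁ : ℝ) (G : E2 → ℝ) (hG : Measurable G) (hG₁ : ∀ x, G x ≤ G₁)
    (μ g : ℝ) (hμ : 0 < μ) (hg : 0 ≤ g)
    (ε : ℕ → ℝ) (hε : ∀ n, 0 < ε n) (hε0 : Tendsto ε atTop (𝓝 0))
    (f : ℕ → E3 → E3) (hf : ∀ n, MemLp (f n) 2 (volume.restrict (thinDomain G (ε n))))
    (C : ℝ) (hfC : ∀ n, rescaledL2Norm G (ε n) (f n) ≤ C)
    (u : ℕ → E3 → E3) (hu : ∀ n, IsBinghamVelocity μ g G (ε n) (f n) (u n)) :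
    (∀ n, MemH10 (fixedDomain G₁) (rescaledVelocity G (ε n) (u n))) ∧
    ∃ W : ℕ → H1 0 G₁ L2omega3,
      (∀ n, Represents (W n) (rescaledVelocity G (ε n) (u n))) ∧
      ∃ (s : ℕ → ℕ) (U : H1 0 G₁ L2omega3),
        StrictMono s ∧
        WeakTendsto (fun k => W (s k)) U ∧
        (∀ᵐ t ∂(volume.restrict (Set.Ioo 0 G₁)), ∀ᵐ x ∂(volume.restrict omega),
          h1Fun U t x 2 = 0) ∧
        HasWeakDiv omega (verticalIntegral U) 0 ∧
        ZeroNormalTrace omega (verticalIntegral U) := by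
  have profile (n : ℕ) := (hu n).exists_represents hμ hg (hε n) hG hG₁ (hf n)
  choose memH10 W represents solenoidal norm_le using profile
  have bounded (n : ℕ) : ‖W n‖ ≤ (2 * |G₁| + 1) * (2 * |G₁| * C / μ) :=
    (norm_le n).trans (by gcongr; exact hfC n)
  have subsequence := exists_weakTendsto_of_bounded bounded
  obtain ⟨s, U, hs, hU⟩ := subsequence
  have vertical := vertical_eq_zero_of_weakTendsto (hε0.comp hs.tendsto_atTop) hU
    fun k => solenoidal (s k)
  have orth (ψ : E2 → ℝ) (Dψ : E2 → Grad 2 ℝ) (hψ : HasH1Grad omega ψ Dψ) :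
      ∫ x in omega, ⟪verticalIntegral U x, Dψ x⟫_ℝ = 0 :=
    integral_inner_verticalIntegral_eq_zero_of_weakTendsto (fun k => (hε (s k)).ne') hU
      (fun k => solenoidal (s k)) hψ
  have weakDiv := hasWeakDiv_zero_of_forall_integral_inner_eq_zero isBounded_omega
    (Lp.memLp _) orth
  exact ⟨memH10, W, represents, s, U, hs, hU, vertical, weakDiv,
    zeroNormalTrace_of_forall_integral_inner_eq_zero weakDiv orth⟩

theorem proposition5p1
    (L₁ L₂ G₀ G₁ : ℝ) (hL₁ : 0 < L₁) (hL₂ : 0 < L₂) (hG₀ : 0 < G₀)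
    (G : BinghamThin.E2 → ℝ) (hG : ContDiff ℝ ∞ G)
    (hper₁ : ∀ x, G (x + EuclideanSpace.single 0 L₁) = G x)
    (hper₂ : ∀ x, G (x + EuclideanSpace.single 1 L₂) = G x)
    (hbd : ∀ x, G₀ ≤ G x ∧ G x ≤ G₁)
    (μ g : ℝ) (hμ : 0 < μ) (hg : 0 < g)
    (ε : ℕ → ℝ) (hε : ∀ n, 0 < ε n) (hε0 : Tendsto ε atTop (𝓝 0))
    (f : ℕ → BinghamThin.E3 → BinghamThin.E3)
    (hf : ∀ n, MemLp (f n) 2 (volume.restrict (BinghamThin.thinDomain G (ε n))))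
    (C : ℝ) (hfC : ∀ n, BinghamThin.rescaledL2Norm G (ε n) (f n) ≤ C)
    (u : ℕ → BinghamThin.E3 → BinghamThin.E3)
    (hu : ∀ n, BinghamThin.IsBinghamVelocity μ g G (ε n) (f n) (u n)) :
    (∀ n, BinghamThin.MemH10 (BinghamThin.fixedDomain G₁)
      (BinghamThin.rescaledVelocity G (ε n) (u n))) ∧
    ∃ W : ℕ → BinghamThin.H1 0 G₁ BinghamThin.L2omega3,
      (∀ n, BinghamThin.Represents (W n) (BinghamThin.rescaledVelocity G (ε n) (u n))) ∧
      ∃ (s : ℕ → ℕ) (U : BinghamThin.H1 0 G₁ BinghamThin.L2omega3),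
        StrictMono s ∧
        BinghamThin.WeakTendsto (fun k => W (s k)) U ∧
        (∀ᵐ t ∂(volume.restrict (Set.Ioo 0 G₁)), ∀ᵐ x ∂(volume.restrict BinghamThin.omega),
          BinghamThin.h1Fun U t x 2 = 0) ∧
        BinghamThin.HasWeakDiv BinghamThin.omega (BinghamThin.verticalIntegral U) 0 ∧
        BinghamThin.ZeroNormalTrace BinghamThin.omega (BinghamThin.verticalIntegral U) :=
  proposition5p1_general G₁ G hG.continuous.measurable (fun x => (hbd x).2) μ g hμ hg.le ε hε hε0
    f hf C hfC u hu
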